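/- A *cohomological functor* $T^\bullet$ from an abelian category $\mathcal C$ to an abelian category $\mathcal D$ is a family of additive functors $(T^n:\mathcal C\to\mathcal D)_{n\in\mathbb Z}$ with natural connecting homomorphisms $\delta^n:T^n(Z)\to T^{n+1}(X)$, one for every short exact sequence $0\to X\to Y\to Z\to 0$ and every $n$, whose long sequences are exact; morphisms are families of natural transformations commuting with the $\delta^n$. It *vanishes on projectives* if $T^n(P)=0$ for all projective $P$ and all $n\in\mathbb Z$. A *Mislin completion* of $T^\bullet$ is a cohomological functor $\widehat T^\bullet$ vanishing on projectives with a morphism $\nu:T^\bullet\to\widehat T^\bullet$ through which every morphism from $T^\bullet$ to a cohomological functor $\mathcal C\to\mathcal D$ vanishing on projectives factors uniquely. For $\mathcal C$ with enough projectives and $A\in\mathcal C$, let $\mathrm{Ext}^\bullet_{\mathcal C}(A,-):\mathcal C\to\mathbf{Ab}$ be the (unenriched) Ext-functors, set to $0$ in negative degrees; the completed unenriched Ext-functors $\widehat{\mathrm{Ext}}{}^\bullet_{\mathcal C}(A,-)$ are their Mislin completion. An object has *finite projective dimension* if it admits a projective resolution of finite length. **Theorem.** (a) Let $\mathcal C$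 be an abelian category with enough projectives. Then $\widehat{\mathrm{Ext}}{}^\bullet_{\mathcal C}(X,-)$ exists for every object $X$, and for every object $A$ the following are equivalent: 1. $A$ has finite projective dimension; 2. $\widehat{\mathrm{Ext}}{}^n_{\mathcal C}(A,B)=0$ and $\widehat{\mathrm{Ext}}{}^n_{\mathcal C}(B,A)=0$ for all objects $B$ of $\mathcal C$ and all $n\in\mathbb Z$; 3. $\widehat{\mathrm{Ext}}{}^0_{\mathcal C}(A,A)=0$. (b) In particular, let $R$ be a ring and $G$ a group, let $H^\bullet_R(G,-)=\mathrm{Ext}^\bullet_{R[G]}(R,-)$, where $G$ acts trivially on $R$, and let the complete cohomology $\widehat H^\bullet_R(G,-)$ be its Mislin completion. It exists, and $\widehat H^0_R(G,R)=0$ if and only if $G$ has finite cohomological dimension over $R$, i.e. the $R[G]$-module $R$ has finite projective dimension. (c) The same applies to condensed groups: let $R$ be a condensed ring, $G$ a condensed group, and $R[G]$ the condensed group ring (the sheaf associated with $S\mapsto R(S)[G(S)]$ on compact Hausdorff spaces). The category of condensed $R[G]$-modules has enough projectives, the Mislin completion $\widehat H^\bullet_R(G,-)$ of the unenriched functors $H^\bullet_R(G,-)=\mathrm{Ext}^\bullet_{R[G]}(R,-)$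 exists, and $\widehat H^0_R(G,R)=0$ if and only if $R$, with trivial action, has finite projective dimension as a condensed $R[G]$-module. (d) Consequently, (c) holds for every $T1$ topological group $G$, taken as the condensed group $S\mapsto C(S,G)$ of continuous maps. -/

import Mathlib

open CategoryTheory Limits

universe w v u

namespace CompleteCohomology

noncomputable section

section CohomologicalFunctors

/-- A cohomological functor from `C` to `D`: additive functors `T n`, for `n : ℤ`, with natural
connecting homomorphisms attached to short exact sequences, such that the resulting long
sequences are exact. -/
structure CohomologicalFunctor (C : Type*) [Category* C] [Abelian C]
    (D : Type*) [Category* D] [Abelian D] where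
  /-- The functor in degree `n`. -/
  T : ℤ → C ⥤ D
  additive : ∀ n, (T n).Additive
  /-- The connecting homomorphism `Tⁿ(S.X₃) ⟶ Tⁿ⁺¹(S.X₁)` of `0 ⟶ S.X₁ ⟶ S.X₂ ⟶ S.X₃ ⟶ 0`. -/
  δ : ∀ (n : ℤ) {S : ShortComplex C}, S.ShortExact → ((T n).obj S.X₃ ⟶ (T (n + 1)).obj S.X₁)
  δ_naturality : ∀ (n : ℤ) {S S' : ShortComplex C} (hS : S.ShortExact) (hS' : S'.ShortExact)
    (φ : S ⟶ S'), (T n).map φ.τ₃ ≫ δ n hS' = δ n hS ≫ (T (n + 1)).map φ.τ₁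
  map_g_comp_δ : ∀ (n : ℤ) {S : ShortComplex C} (hS : S.ShortExact), (T n).map S.g ≫ δ n hS = 0
  δ_comp_map_f : ∀ (n : ℤ) {S : ShortComplex C} (hS : S.ShortExact),
    δ n hS ≫ (T (n + 1)).map S.f = 0
  map_f_comp_map_g : ∀ (n : ℤ) {S : ShortComplex C}, S.ShortExact →
    (T n).map S.f ≫ (T n).map S.g = 0
  exact₁ : ∀ (n : ℤ) {S : ShortComplex C} (hS : S.ShortExact),
    (ShortComplex.mk _ _ (δ_comp_map_f n hS)).Exact
  exact₂ : ∀ (n : ℤ) {S : ShortComplex C} (hS : S.ShortExact),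
    (ShortComplex.mk _ _ (map_f_comp_map_g n hS)).Exact
  exact₃ : ∀ (n : ℤ) {S : ShortComplex C} (hS : S.ShortExact),
    (ShortComplex.mk _ _ (map_g_comp_δ n hS)).Exact

variable {C : Type*} [Category* C] [Abelian C] {D : Type*} [Category* D] [Abelian D]

/-- A morphism of cohomological functors: natural transformations in every degree that commute
with the connecting homomorphisms. -/
@[ext]
structure CohomologicalFunctor.Hom (T U : CohomologicalFunctor C D) where
  /-- The natural transformation in degree `n`. -/
  app : ∀ n : ℤ, T.T n ⟶ U.T n
  comm : ∀ (n : ℤ) {S : ShortComplex C} (hS : S.ShortExact),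
    T.δ n hS ≫ (app (n + 1)).app S.X₁ = (app n).app S.X₃ ≫ U.δ n hS

/-- Composition of morphisms of cohomological functors. -/
def CohomologicalFunctor.Hom.comp {T U V : CohomologicalFunctor C D} (f : T.Hom U) (g : U.Hom V) :
    T.Hom V where
  app n := f.app n ≫ g.app n
  comm n S hS := by
    simp only [NatTrans.comp_app, Category.assoc]
    rw [← Category.assoc, f.comm, Category.assoc, g.comm]

/-- A cohomological functor vanishes on projectives if it is zero in all degrees on every
projective object. -/
def CohomologicalFunctor.VanishesOnProjectives (T : CohomologicalFunctor C D) : Prop :=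
  ∀ (n : ℤ) (P : C), Projective P → IsZero ((T.T n).obj P)

/-- A Mislin completion of `T`: the initial morphism from `T` to a cohomological functor that
vanishes on projectives. -/
structure MislinCompletion (T : CohomologicalFunctor C D) where
  /-- The completed cohomological functor. -/
  functor : CohomologicalFunctor C D
  /-- The canonical morphism. -/
  ν : T.Hom functor
  vanishesOnProjectives : functor.VanishesOnProjectives
  existsUnique_fac : ∀ (U : CohomologicalFunctor C D), U.VanishesOnProjectives →
    ∀ f : T.Hom U, ∃! g : functor.Hom U, ν.comp g = f

end CohomologicalFunctors

section Ext

open Abelian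

variable {C : Type u} [Category.{v} C] [Abelian C] [HasExt.{w} C]

/-- The functor `Extⁿ(X, -)` to abelian groups, for `n : ℤ`; it is zero for `n < 0`. -/
def extFunctorInt (X : C) : ℤ → C ⥤ AddCommGrpCat.{w}
  | .ofNat n => extFunctorObj X n
  | .negSucc _ => (Functor.const C).obj (AddCommGrpCat.of PUnit)

/-- The connecting homomorphism `Extⁿ(X, S.X₃) ⟶ Extⁿ⁺¹(X, S.X₁)`: the Yoneda product with the
class of the short exact sequence in degrees `n ≥ 0`, and zero in degrees `n < 0`. -/
def extδ (X : C) : ∀ (n : ℤ) {S : ShortComplex C}, S.ShortExact →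
    ((extFunctorInt X n).obj S.X₃ ⟶ (extFunctorInt X (n + 1)).obj S.X₁)
  | .ofNat _, _, hS => AddCommGrpCat.ofHom (hS.extClass.postcomp X rfl)
  | .negSucc _, _, _ => 0

lemma isZero_extFunctorInt_negSucc (X : C) (n : ℕ) (Y : C) :
    IsZero ((extFunctorInt X (.negSucc n)).obj Y) :=
  AddCommGrpCat.isZero_of_subsingleton (AddCommGrpCat.of PUnit)

lemma map_g_comp_extδ (X : C) (n : ℤ) {S : ShortComplex C} (hS : S.ShortExact) :
    (extFunctorInt X n).map S.g ≫ extδ X n hS = 0 := by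
  rcases n with n | n
  · ext (x : Ext X S.X₂ n)
    change (x.comp (Ext.mk₀ S.g) (add_zero n)).comp hS.extClass rfl = 0
    simp
  · exact (isZero_extFunctorInt_negSucc X n _).eq_of_src _ _

lemma extδ_comp_map_f (X : C) (n : ℤ) {S : ShortComplex C} (hS : S.ShortExact) :
    extδ X n hS ≫ (extFunctorInt X (n + 1)).map S.f = 0 := by
  rcases n with n | n
  · ext (x : Ext X S.X₃ n)
    change (x.comp hS.extClass rfl).comp (Ext.mk₀ S.f) (add_zero (n + 1)) = 0
    simp
  · exact (isZero_extFunctorInt_negSucc X n _).eq_of_src _ _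

lemma extFunctorInt_map_f_comp_map_g (X : C) (n : ℤ) (S : ShortComplex C) :
    (extFunctorInt X n).map S.f ≫ (extFunctorInt X n).map S.g = 0 := by
  rcases n with n | n
  · ext (x : Ext X S.X₁ n)
    change (x.comp (Ext.mk₀ S.f) (add_zero n)).comp (Ext.mk₀ S.g) (add_zero n) = 0
    simp
  · exact (isZero_extFunctorInt_negSucc X n _).eq_of_src _ _

/-- The Ext functors `Ext^•(X, -)`, extended by zero to negative degrees, as a cohomological
functor. -/
def extCohomologicalFunctorOfHasExt (X : C) : CohomologicalFunctor C AddCommGrpCat.{w} where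
  T := extFunctorInt X
  additive
    | .ofNat n => inferInstanceAs (extFunctorObj X n).Additive
    | .negSucc n => ⟨fun {_ _ _ _} ↦ (isZero_extFunctorInt_negSucc X n _).eq_of_src _ _⟩
  δ := extδ X
  δ_naturality n S S' hS hS' φ := by
    rcases n with n | n
    · ext (x : Ext X S.X₃ n)
      change (x.comp (Ext.mk₀ φ.τ₃) (add_zero n)).comp hS'.extClass rfl =
        (x.comp hS.extClass rfl).comp (Ext.mk₀ φ.τ₁) (add_zero (n + 1))
      rw [Ext.comp_assoc (a₁₂ := n) (a₂₃ := 1) _ _ _ (by lia) (by lia) (by lia),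
        Ext.comp_assoc (a₁₂ := n + 1) (a₂₃ := 1) _ _ _ (by lia) (by lia) (by lia),
        ShortComplex.ShortExact.extClass_naturality hS hS' φ]
    · exact (isZero_extFunctorInt_negSucc X n _).eq_of_src _ _
  map_g_comp_δ n S hS := map_g_comp_extδ X n hS
  δ_comp_map_f n S hS := extδ_comp_map_f X n hS
  map_f_comp_map_g n S hS := extFunctorInt_map_f_comp_map_g X n S
  exact₁ n S hS := by
    rcases n with n | _ | n
    · exact Ext.covariant_sequence_exact₁' X hS n (n + 1) rfl
    · have := hS.mono_f
      refine (ShortComplex.exact_iff_mono _ rfl).2 ?_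
      exact Ext.mono_postcomp_mk₀_of_mono X S.f
    · exact ShortComplex.exact_of_isZero_X₂ _ (isZero_extFunctorInt_negSucc X n S.X₁)
  exact₂ n S hS := by
    rcases n with n | n
    · exact Ext.covariant_sequence_exact₂' X hS n
    · exact ShortComplex.exact_of_isZero_X₂ _ (isZero_extFunctorInt_negSucc X n S.X₂)
  exact₃ n S hS := by
    rcases n with n | n
    · exact Ext.covariant_sequence_exact₃' X hS n (n + 1) rfl
    · exact ShortComplex.exact_of_isZero_X₂ _ (isZero_extFunctorInt_negSucc X n S.X₃)

end Ext

section CompletedExt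

variable {C : Type u} [Category.{v} C] [Abelian C]

/-- `X` has finite projective dimension: it admits a projective resolution of finite length. -/
def HasFiniteProjectiveDimension (X : C) : Prop :=
  ∃ (P : ProjectiveResolution X) (N : ℕ), ∀ n : ℕ, N < n → IsZero (P.complex.X n)

/-- The unenriched Ext functors `Ext^•(X, -) : C ⥤ Ab` of an abelian category with enough
projectives, extended by zero to negative degrees. The groups `Extⁿ(X, Y)` live in the universe of
the morphisms of `C`, which is possible since `C` has enough projectives. -/
def extCohomologicalFunctor [EnoughProjectives C] (X : C) : CohomologicalFunctor C AddCommGrpCat.{v} :=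
  letI : HasExt.{v} C := hasExt_of_enoughProjectives.{v} C
  extCohomologicalFunctorOfHasExt X

end CompletedExt

section DiscreteGroups

variable (R : Type u) [Ring R] (G : Type u) [Group G]

/-- The augmentation `R[G] → R`, sending every `g : G` to `1`. -/
def augmentation : MonoidAlgebra R G →+* R :=
  MonoidAlgebra.liftNCRingHom (RingHom.id R) (1 : G →* R) fun _ _ ↦ Commute.one_right _

/-- The `R[G]`-module `R` with trivial action of `G`. -/
def trivialModule : ModuleCat.{u} (MonoidAlgebra R G) :=
  (ModuleCat.restrictScalars (augmentation R G)).obj (ModuleCat.of R R)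

/-- The cohomology `H_R^•(G, -) = Ext_{R[G]}^•(R, -)` of a group `G` over a ring `R`. -/
def groupCohomologyFunctor :
    CohomologicalFunctor (ModuleCat.{u} (MonoidAlgebra R G)) AddCommGrpCat.{u} :=
  extCohomologicalFunctor (trivialModule R G)

/-- `G` has finite cohomological dimension over `R`. -/
def HasFiniteCohomologicalDimension : Prop :=
  HasFiniteProjectiveDimension (trivialModule R G)

end DiscreteGroups

section CondensedGroups

variable (R : Condensed.{u} RingCat.{u + 1}) (G : Condensed.{u} GrpCat.{u + 1})

/-- The presheaf of group rings `S ↦ R(S)[G(S)]`. -/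
def groupRingPresheaf : CompHaus.{u}ᵒᵖ ⥤ RingCat.{u + 1} where
  obj S := RingCat.of (MonoidAlgebra (R.obj.obj S) (G.obj.obj S))
  map f := RingCat.ofHom
    ((MonoidAlgebra.mapRingHom _ (R.obj.map f).hom).comp
      (MonoidAlgebra.mapDomainRingHom _ (G.obj.map f).hom))
  map_id S := by ext x <;> simp
  map_comp f g := by ext x <;> simp

/-- The augmentation `R(S)[G(S)] → R(S)`, natural in `S`. -/
def groupRingPresheafAugmentation : groupRingPresheaf R G ⟶ R.obj where
  app S := RingCat.ofHom (augmentation (R.obj.obj S) (G.obj.obj S))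
  naturality S T f := by
    refine RingCat.hom_ext (MonoidAlgebra.ringHom_ext (fun r ↦ ?_) (fun g ↦ ?_)) <;>
      simp [groupRingPresheaf, augmentation]

/-- The condensed group ring `R[G]`, the sheaf associated with `S ↦ R(S)[G(S)]`. -/
def condensedGroupRing : Condensed.{u} RingCat.{u + 1} :=
  (presheafToSheaf (coherentTopology CompHaus.{u}) RingCat.{u + 1}).obj (groupRingPresheaf R G)

/-- The augmentation `R[G] ⟶ R` of the condensed group ring. -/
def condensedAugmentation : condensedGroupRing R G ⟶ R :=
  ((sheafificationAdjunction (coherentTopology CompHaus.{u}) RingCat.{u + 1}).homEquiv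
    (groupRingPresheaf R G) R).symm (groupRingPresheafAugmentation R G)

/-- The category `Mod_R(G)` of condensed `R`-modules with a compatible action of `G`, that is, of
condensed modules over the condensed group ring `R[G]`. -/
abbrev CondensedGroupModule := SheafOfModules.{u + 1} (condensedGroupRing R G)

/-- The condensed module `R` with trivial action of `G`. -/
def condensedTrivialModule : CondensedGroupModule R G :=
  (SheafOfModules.restrictScalars (condensedAugmentation R G)).obj (SheafOfModules.unit R)

/-- The unenriched cohomology `H_R^•(G, -) = Ext_{R[G]}^•(R, -)` of a condensed group `G` over a
condensed ring `R`. -/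
def condensedGroupCohomologyFunctor [EnoughProjectives (CondensedGroupModule R G)] :
    CohomologicalFunctor (CondensedGroupModule R G) AddCommGrpCat.{u + 1} :=
  extCohomologicalFunctor (condensedTrivialModule R G)

/-- The condensed group `G` has finite cohomological dimension over the condensed ring `R`. -/
def HasFiniteCondensedCohomologicalDimension : Prop :=
  HasFiniteProjectiveDimension (condensedTrivialModule R G)

end CondensedGroups

section TopologicalGroups

variable (G : Type (u + 1)) [Group G] [TopologicalSpace G] [IsTopologicalGroup G]

/-- The presheaf of groups `S ↦ C(S, G)` of continuous maps into a topological group. -/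
def continuousMapsPresheaf : CompHaus.{u}ᵒᵖ ⥤ GrpCat.{u + 1} where
  obj S := GrpCat.of C(S.unop, G)
  map f := GrpCat.ofHom
    { toFun := fun g ↦ g.comp f.unop.hom.hom
      map_one' := rfl
      map_mul' := fun _ _ ↦ rfl }

/-- The condensed group `S ↦ C(S, G)` of a topological group. -/
def condensedGroupOfTopologicalGroup : Condensed.{u} GrpCat.{u + 1} where
  obj := continuousMapsPresheaf G
  property := by
    apply Presheaf.isSheaf_of_isSheaf_comp _ _ (forget GrpCat.{u + 1})
    exact (TopCat.toCondensedSet (TopCat.of G)).property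

end TopologicalGroups

end

end CompleteCohomology

/-!
# Mislin completions of Ext functors and finite projective dimension

Write `ΩX` for the kernel of a chosen epimorphism from a projective object to `X`. For a
cohomological functor `T` on an abelian category with enough projectives, with values in abelian
groups, the completion is constructed as the colimit of

`Tⁿ(X) ⟶ Tⁿ⁺¹(ΩX) ⟶ Tⁿ⁺²(Ω²X) ⟶ ⋯`

along connecting homomorphisms. The syzygy `Ω` is a functor only up to maps that factor through
projective objects, but a connecting homomorphism to a syzygy kills such maps, so the colimit is a
functor, and it vanishes on projective objects. Since `Tⁿ⁺ᵏ⁺¹(Ωᵏ⁺¹X)` is also the group with index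
`k` for `ΩX` in degree `n + 1`, dropping the first term of the sequence identifies the completion at
`X` in degree `n` with the completion at `ΩX` in degree `n + 1` (`shiftHom`). The connecting
homomorphism of `0 ⟶ X ⟶ Y ⟶ Z ⟶ 0` is this identification for `Z` followed by the map `ΩZ ⟶ X`.

Exactness at the middle term follows from exactness for `T` by passing to the sequences of syzygies
provided by the horseshoe lemma (`horseshoe`), and exactness at the other two terms is exactness at
the middle term of rotated sequences `0 ⟶ ΩZ ⟶ X ⊞ P ⟶ Y ⟶ 0` (`rotate`). The universal property
(`mislinCompletion`) holds because the connecting homomorphisms `Uⁿ(X) ⟶ Uⁿ⁺¹(ΩX)` are invertible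
for every `U` vanishing on projectives.

If `A` has finite projective dimension then `Ext^•(A, -)` vanishes in high degrees, so all terms of
the sequences are eventually zero, while dimension shifting along a finite projective resolution
shows that every cohomological functor vanishing on projectives vanishes on `A`. Conversely, if the
completion of `Ext⁰(A, A)` is zero then the image of the identity of `A` in `Extᵏ(A, ΩᵏA)` is zero
for some `k`. By dimension shifting every class in `Extᵐ(A, Y)` with `m > k` is a multiple of this
image, so these groups vanish and `A` has finite projective dimension.

Condensed modules over a condensed ring have enough projectives
(`enoughProjectives_condensedModule`) since the family of sections over all extremally disconnected
compact Hausdorff spaces is a faithful right adjoint functor that preserves epimorphisms, with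
values in a category all of whose objects are projective.
-/

namespace CompleteCohomology

noncomputable section

/-! ### Syzygies and stable maps -/

section Stable

variable {C : Type u} [Category.{v} C]

/-- A morphism is stably zero if it factors through a projective object. -/
def StablyZero {X Y : C} (f : X ⟶ Y) : Prop :=
  ∃ (P : C) (_ : Projective P) (a : X ⟶ P) (b : P ⟶ Y), a ≫ b = f

lemma stablyZero_of_projective {X Y : C} [Projective X] (f : X ⟶ Y) : StablyZero f :=
  ⟨X, inferInstance, 𝟙 X, f, Category.id_comp f⟩

variable [Abelian C]

lemma stablyZero_zero (X Y : C) : StablyZero (0 : X ⟶ Y) :=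
  ⟨_, (isZero_zero C).projective, 0, 0, comp_zero⟩

lemma stablyZero_of_eq {X Y : C} {f g : X ⟶ Y} (h : f = g) : StablyZero (f - g) := by
  rw [h, sub_self]
  exact stablyZero_zero X Y

/-- Morphisms of short exact sequences extending a given map on the third terms exist as soon as
the middle term of the source is projective. -/
lemma exists_hom_of_projective {S S' : ShortComplex C} (hS' : S'.ShortExact)
    [Projective S.X₂] (f : S.X₃ ⟶ S'.X₃) : ∃ φ : S ⟶ S', φ.τ₃ = f := by
  have := hS'.epi_g
  have := hS'.mono_f
  let p : S.X₂ ⟶ S'.X₂ := Projective.factorThru (S.g ≫ f) S'.g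
  have hp : p ≫ S'.g = S.g ≫ f := Projective.factorThru_comp _ _
  refine ⟨⟨hS'.exact.lift (S.f ≫ p) ?_, p, f, hS'.exact.lift_f _ _, hp⟩, rfl⟩
  rw [Category.assoc, hp, S.zero_assoc, zero_comp]

/-- Passing to syzygies preserves stably zero maps, whichever lifts are chosen. -/
lemma stablyZero_τ₁ {S S' : ShortComplex C} (hS' : S'.ShortExact) [Projective S.X₂]
    (φ : S ⟶ S') (h : StablyZero φ.τ₃) : StablyZero φ.τ₁ := by
  have := hS'.epi_g
  have := hS'.mono_f
  obtain ⟨Q, _, a, b, hab⟩ := h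
  let c : Q ⟶ S'.X₂ := Projective.factorThru b S'.g
  have hc : c ≫ S'.g = b := Projective.factorThru_comp _ _
  -- `φ.τ₂` and `S.g ≫ a ≫ c` have the same composite with `S'.g`, so they differ by a map to
  -- `S'.X₁`
  have hz : (φ.τ₂ - S.g ≫ a ≫ c) ≫ S'.g = 0 := by
    simp [Preadditive.sub_comp, hc, hab, φ.comm₂₃]
  refine ⟨S.X₂, inferInstance, S.f, hS'.exact.lift _ hz, ?_⟩
  rw [← cancel_mono S'.f, Category.assoc, ShortComplex.Exact.lift_f, Preadditive.comp_sub,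
    S.zero_assoc, zero_comp, sub_zero, φ.comm₁₂]

variable [EnoughProjectives C]

/-- The syzygy of `X`: the kernel of the chosen epimorphism from a projective object. -/
abbrev syzygy (X : C) : C := kernel (Projective.π X)

/-- The short exact sequence `0 ⟶ syzygy X ⟶ Projective.over X ⟶ X ⟶ 0`. -/
abbrev syzygySeq (X : C) : ShortComplex C :=
  ShortComplex.mk (kernel.ι (Projective.π X)) (Projective.π X) (kernel.condition _)

lemma syzygySeq_shortExact (X : C) : (syzygySeq X).ShortExact where
  exact := ShortComplex.exact_kernel _

/-- A chosen morphism from `syzygySeq S.X₃` to a short exact sequence `S` which is the identity on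
the third terms. -/
def fromSyzygySeq {S : ShortComplex C} (hS : S.ShortExact) : syzygySeq S.X₃ ⟶ S :=
  (exists_hom_of_projective (S := syzygySeq S.X₃) hS (𝟙 S.X₃)).choose

@[simp]
lemma fromSyzygySeq_τ₃ {S : ShortComplex C} (hS : S.ShortExact) :
    (fromSyzygySeq hS).τ₃ = 𝟙 S.X₃ :=
  (exists_hom_of_projective (S := syzygySeq S.X₃) hS (𝟙 S.X₃)).choose_spec

/-- A chosen morphism of syzygy sequences extending `f`; it is functorial only up to stably zero
maps. -/
def syzygySeqMap {X Y : C} (f : X ⟶ Y) : syzygySeq X ⟶ syzygySeq Y :=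
  (exists_hom_of_projective (S := syzygySeq X) (syzygySeq_shortExact Y) f).choose

@[simp]
lemma syzygySeqMap_τ₃ {X Y : C} (f : X ⟶ Y) : (syzygySeqMap f).τ₃ = f :=
  (exists_hom_of_projective (S := syzygySeq X) (syzygySeq_shortExact Y) f).choose_spec

/-- The map on syzygies induced by `f`, well defined up to stably zero maps. -/
def syzygyMap {X Y : C} (f : X ⟶ Y) : syzygy X ⟶ syzygy Y := (syzygySeqMap f).τ₁

lemma stablyZero_syzygyMap_sub {X Y : C} {f g : X ⟶ Y} (h : StablyZero (f - g)) :
    StablyZero (syzygyMap f - syzygyMap g) :=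
  stablyZero_τ₁ (S := syzygySeq X) (syzygySeq_shortExact Y) (syzygySeqMap f - syzygySeqMap g)
    (by simpa using h)

lemma stablyZero_syzygyMap_comp {X Y Z : C} {f : X ⟶ Y} {g : Y ⟶ Z} {h : X ⟶ Z}
    (H : StablyZero (h - f ≫ g)) : StablyZero (syzygyMap h - syzygyMap f ≫ syzygyMap g) :=
  stablyZero_τ₁ (S := syzygySeq X) (syzygySeq_shortExact Z)
    (syzygySeqMap h - syzygySeqMap f ≫ syzygySeqMap g) (by simpa using H)

lemma stablyZero_syzygyMap_add {X Y : C} {f g h : X ⟶ Y} (H : StablyZero (h - (f + g))) :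
    StablyZero (syzygyMap h - (syzygyMap f + syzygyMap g)) :=
  stablyZero_τ₁ (S := syzygySeq X) (syzygySeq_shortExact Y)
    (syzygySeqMap h - (syzygySeqMap f + syzygySeqMap g)) (by simpa using H)

lemma stablyZero_syzygyMap_sub_id {X : C} {f : X ⟶ X} (H : StablyZero (f - 𝟙 X)) :
    StablyZero (syzygyMap f - 𝟙 (syzygy X)) :=
  stablyZero_τ₁ (S := syzygySeq X) (syzygySeq_shortExact X)
    (syzygySeqMap f - 𝟙 _) (by simpa using H)

end Stable

/-! ### Rotation and syzygies of short exact sequences -/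

section Sequences

variable {C : Type u} [Category.{v} C] [Abelian C] {S : ShortComplex C} (hS : S.ShortExact)

include hS in
lemma epi_biprod_desc {A P : C} (a : A ⟶ S.X₁) [Epi a] (p : P ⟶ S.X₂) [Epi (p ≫ S.g)] :
    Epi (biprod.desc (a ≫ S.f) p) := by
  have := hS.epi_g
  refine Preadditive.epi_of_cancel_zero _ fun {W} h hh ↦ ?_
  have h1 : S.f ≫ h = 0 := by
    rw [← cancel_epi a]
    simpa using biprod.inl ≫= hh
  have h2 : p ≫ h = 0 := by simpa using biprod.inr ≫= hh
  have h3 : S.g ≫ hS.exact.desc h h1 = h := hS.exact.g_desc _ _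
  have h4 : hS.exact.desc h h1 = 0 := by
    rw [← cancel_epi (p ≫ S.g), Category.assoc, h3, h2, comp_zero]
  rw [← h3, h4, comp_zero]

variable [EnoughProjectives C]

/-- The rotated sequence `0 ⟶ syzygy Z ⟶ X ⊞ P ⟶ Y ⟶ 0` of a short exact sequence
`0 ⟶ X ⟶ Y ⟶ Z ⟶ 0`, where `P` is the chosen projective object over `Z`. -/
abbrev rotate : ShortComplex C :=
  ShortComplex.mk (X₁ := syzygy S.X₃) (X₂ := S.X₁ ⊞ Projective.over S.X₃) (X₃ := S.X₂)
    (biprod.lift (-(fromSyzygySeq hS).τ₁) (syzygySeq S.X₃).f)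
    (biprod.desc S.f (fromSyzygySeq hS).τ₂) (by
      rw [biprod.lift_desc, Preadditive.neg_comp, (fromSyzygySeq hS).comm₁₂]
      exact neg_add_cancel _)

lemma fromSyzygySeq_τ₂_comp_g : (fromSyzygySeq hS).τ₂ ≫ S.g = Projective.π S.X₃ := by
  rw [(fromSyzygySeq hS).comm₂₃, fromSyzygySeq_τ₃, Category.comp_id]

lemma rotate_shortExact : (rotate hS).ShortExact where
  exact := by
    have := hS.mono_f
    rw [ShortComplex.exact_iff_exact_up_to_refinements]
    intro A x hx
    have hx' : (x ≫ biprod.fst) ≫ S.f + (x ≫ biprod.snd) ≫ (fromSyzygySeq hS).τ₂ = 0 := by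
      rw [← hx]
      dsimp only
      rw [biprod.desc_eq, Preadditive.comp_add, Category.assoc,
        Category.assoc]
    have h2 : (x ≫ biprod.snd) ≫ Projective.π S.X₃ = 0 := by
      have := hx' =≫ S.g
      simpa [fromSyzygySeq_τ₂_comp_g hS] using this
    refine ⟨A, 𝟙 A, inferInstance, kernel.lift _ _ h2, ?_⟩
    rw [Category.id_comp]
    apply biprod.hom_ext
    · rw [← cancel_mono S.f]
      simp only [Category.assoc, biprod.lift_fst, Preadditive.neg_comp, Preadditive.comp_neg,
        (fromSyzygySeq hS).comm₁₂, kernel.lift_ι_assoc]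
      rw [eq_neg_iff_add_eq_zero]
      simpa using hx'
    · simp
  mono_f := by
    have : Mono ((rotate hS).f ≫ biprod.snd) := by
      simp only [biprod.lift_snd]
      infer_instance
    exact mono_of_mono _ biprod.snd
  epi_g := by
    have : Epi ((fromSyzygySeq hS).τ₂ ≫ S.g) := by
      rw [fromSyzygySeq_τ₂_comp_g]
      infer_instance
    simpa using epi_biprod_desc hS (𝟙 S.X₁) (fromSyzygySeq hS).τ₂

/-- The map from the rotated sequence to the syzygy sequence which is the identity on first terms
and `S.g` on third terms. -/
abbrev rotateHom : rotate hS ⟶ syzygySeq S.X₃ where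
  τ₁ := 𝟙 _
  τ₂ := biprod.snd
  τ₃ := S.g
  comm₁₂ := by simp
  comm₂₃ := by
    dsimp only
    apply biprod.hom_ext' <;> simp [fromSyzygySeq_τ₂_comp_g hS]

/-- The epimorphism from a projective object to the middle term in the horseshoe lemma. -/
abbrev horseshoeπ : Projective.over S.X₁ ⊞ Projective.over S.X₃ ⟶ S.X₂ :=
  biprod.desc (Projective.π S.X₁ ≫ S.f) (fromSyzygySeq hS).τ₂

lemma horseshoeπ_comp_g : horseshoeπ hS ≫ S.g = biprod.snd ≫ Projective.π S.X₃ := by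
  apply biprod.hom_ext' <;> simp [fromSyzygySeq_τ₂_comp_g hS]

/-- The syzygy of the middle term of a short exact sequence `0 ⟶ X ⟶ Y ⟶ Z ⟶ 0` relative to a
projective presentation which is compatible with those of `X` and `Z`. -/
abbrev middleSyzygySeq : ShortComplex C :=
  ShortComplex.mk (kernel.ι (horseshoeπ hS)) (horseshoeπ hS) (kernel.condition _)

lemma middleSyzygySeq_shortExact : (middleSyzygySeq hS).ShortExact where
  exact := ShortComplex.exact_kernel _
  epi_g := by
    have : Epi ((fromSyzygySeq hS).τ₂ ≫ S.g) := by
      rw [fromSyzygySeq_τ₂_comp_g]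
      infer_instance
    exact epi_biprod_desc hS (Projective.π S.X₁) (fromSyzygySeq hS).τ₂

/-- The map of syzygy sequences over `S.f`. -/
abbrev toMiddleSyzygySeq : syzygySeq S.X₁ ⟶ middleSyzygySeq hS where
  τ₁ := kernel.lift _ (kernel.ι _ ≫ biprod.inl) (by simp)
  τ₂ := biprod.inl
  τ₃ := S.f
  comm₁₂ := by simp
  comm₂₃ := by simp

/-- The map of syzygy sequences over `S.g`. -/
abbrev fromMiddleSyzygySeq : middleSyzygySeq hS ⟶ syzygySeq S.X₃ where
  τ₁ := kernel.lift _ (kernel.ι _ ≫ biprod.snd) (by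
    rw [Category.assoc, ← horseshoeπ_comp_g hS, kernel.condition_assoc, zero_comp])
  τ₂ := biprod.snd
  τ₃ := S.g
  comm₁₂ := by simp
  comm₂₃ := (horseshoeπ_comp_g hS).symm

/-- The sequence of syzygies of the terms of a short exact sequence. -/
abbrev horseshoe : ShortComplex C :=
  ShortComplex.mk (toMiddleSyzygySeq hS).τ₁ (fromMiddleSyzygySeq hS).τ₁ (by
    rw [← cancel_mono (kernel.ι _)]
    simp)

lemma horseshoe_shortExact : (horseshoe hS).ShortExact where
  exact := by
    have := hS.mono_f
    rw [ShortComplex.exact_iff_exact_up_to_refinements]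
    intro A x hx
    have h2 : (x ≫ kernel.ι _) ≫ biprod.snd = 0 := by
      simpa using hx =≫ kernel.ι _
    have h1 : ((x ≫ kernel.ι _) ≫ biprod.fst) ≫ Projective.π S.X₁ = 0 := by
      have h : (x ≫ kernel.ι (horseshoeπ hS)) ≫ (biprod.fst ≫ Projective.π S.X₁ ≫ S.f +
          biprod.snd ≫ (fromSyzygySeq hS).τ₂) = 0 := by
        rw [← biprod.desc_eq, Category.assoc, kernel.condition, comp_zero]
      rw [Preadditive.comp_add, ← Category.assoc _ biprod.snd, h2, zero_comp, add_zero] at h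
      rw [← cancel_mono S.f, zero_comp, ← h]
      simp only [Category.assoc]
    refine ⟨A, 𝟙 A, inferInstance, kernel.lift _ _ h1, ?_⟩
    rw [← cancel_mono (kernel.ι _)]
    apply biprod.hom_ext
    · simp
    · simpa using h2
  mono_f := by
    have : Mono ((horseshoe hS).f ≫ kernel.ι _ ≫ biprod.fst) := by
      simp only [kernel.lift_ι_assoc, Category.assoc, biprod.inl_fst, Category.comp_id]
      infer_instance
    exact mono_of_mono _ (kernel.ι _ ≫ biprod.fst)
  epi_g := by
    have := hS.mono_f
    rw [epi_iff_surjective_up_to_refinements]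
    intro A z
    -- the image of `z` in `Y` comes from `X`, and correcting by a lift of it to the projective
    -- object over `X` yields an element of the kernel
    have h0 : (z ≫ kernel.ι _ ≫ (fromSyzygySeq hS).τ₂) ≫ S.g = 0 := by
      simp [fromSyzygySeq_τ₂_comp_g hS]
    obtain ⟨A', π, hπ, a, ha⟩ := surjective_up_to_refinements_of_epi (Projective.π S.X₁)
      (hS.exact.lift _ h0)
    have h1 : a ≫ Projective.π S.X₁ ≫ S.f = π ≫ z ≫ kernel.ι _ ≫ (fromSyzygySeq hS).τ₂ := by
      rw [← reassoc_of% ha, hS.exact.lift_f]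
    refine ⟨A', π, hπ, kernel.lift _ (biprod.lift (-a) (π ≫ z ≫ kernel.ι _)) ?_, ?_⟩
    · simp [h1]
    · rw [← cancel_mono (kernel.ι _)]
      simp

end Sequences

/-! ### The completion of a cohomological functor -/

section Completion

variable {C : Type u} [Category.{v} C] [Abelian C]

namespace CohomologicalFunctor

instance {D : Type*} [Category* D] [Abelian D] (T : CohomologicalFunctor C D) (n : ℤ) :
    (T.T n).Additive := T.additive n

variable [EnoughProjectives C]

/-- Connecting homomorphisms to syzygies kill stably zero maps. -/
lemma map_comp_δ_of_stablyZero {D : Type*} [Category* D] [Abelian D]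
    (T : CohomologicalFunctor C D) (n : ℤ) {X Y : C} {f : X ⟶ Y} (hf : StablyZero f) :
    (T.T n).map f ≫ T.δ n (syzygySeq_shortExact Y) = 0 := by
  obtain ⟨P, _, a, b, rfl⟩ := hf
  have h := T.map_g_comp_δ n (syzygySeq_shortExact Y)
  rw [← Projective.factorThru_comp b (Projective.π Y)]
  simp only [Functor.map_comp, Category.assoc]
  erw [h]
  simp

variable (T : CohomologicalFunctor C AddCommGrpCat.{w})

/-- The value `Tⁿ⁺ᵏ(Ωᵏ X)` at the `k`-th syzygy `Ωᵏ X` of `X`. -/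
def stage : ℕ → ℤ → C → AddCommGrpCat.{w}
  | 0, n, X => (T.T n).obj X
  | k + 1, n, X => stage k (n + 1) (syzygy X)

/-- The map `Tⁿ⁺ᵏ(Ωᵏ X) ⟶ Tⁿ⁺ᵏ(Ωᵏ Y)` induced by the chosen lift of `X ⟶ Y` to syzygies. -/
def stageMap : ∀ (k : ℕ) (n : ℤ) {X Y : C} (_ : X ⟶ Y), T.stage k n X ⟶ T.stage k n Y
  | 0, n, _, _, f => (T.T n).map f
  | k + 1, n, _, _, f => stageMap k (n + 1) (syzygyMap f)

/-- The connecting homomorphism `Tⁿ⁺ᵏ(Ωᵏ X) ⟶ Tⁿ⁺ᵏ⁺¹(Ωᵏ⁺¹ X)`. -/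
def transition : ∀ (k : ℕ) (n : ℤ) (X : C), T.stage k n X ⟶ T.stage (k + 1) n X
  | 0, n, X => T.δ n (syzygySeq_shortExact X)
  | k + 1, n, X => transition k (n + 1) (syzygy X)

lemma transition_naturality (k : ℕ) (n : ℤ) {X Y : C} (f : X ⟶ Y) :
    T.transition k n X ≫ T.stageMap (k + 1) n f = T.stageMap k n f ≫ T.transition k n Y := by
  induction k generalizing n X Y with
  | zero =>
    have := T.δ_naturality n (syzygySeq_shortExact X) (syzygySeq_shortExact Y) (syzygySeqMap f)
    rw [syzygySeqMap_τ₃] at this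
    exact this.symm
  | succ k ih => exact ih (n + 1) (syzygyMap f)

lemma stageMap_comp_transition_of_stably_eq (k : ℕ) (n : ℤ) {X Y : C} {f g : X ⟶ Y}
    (h : StablyZero (f - g)) :
    T.stageMap k n f ≫ T.transition k n Y = T.stageMap k n g ≫ T.transition k n Y := by
  induction k generalizing n X Y with
  | zero =>
    have := T.map_comp_δ_of_stablyZero n h
    rw [Functor.map_sub, Preadditive.sub_comp, sub_eq_zero] at this
    exact this
  | succ k ih => exact ih (n + 1) (stablyZero_syzygyMap_sub h)

lemma stageMap_comp_transition_of_stably_comp (k : ℕ) (n : ℤ) {X Y Z : C} {f : X ⟶ Y} {g : Y ⟶ Z}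
    {h : X ⟶ Z} (H : StablyZero (h - f ≫ g)) :
    T.stageMap k n h ≫ T.transition k n Z =
      (T.stageMap k n f ≫ T.stageMap k n g) ≫ T.transition k n Z := by
  induction k generalizing n X Y Z with
  | zero =>
    have := T.map_comp_δ_of_stablyZero n H
    rw [Functor.map_sub, Preadditive.sub_comp, sub_eq_zero, Functor.map_comp] at this
    exact this
  | succ k ih => exact ih (n + 1) (stablyZero_syzygyMap_comp H)

lemma stageMap_comp_transition_of_stably_add (k : ℕ) (n : ℤ) {X Y : C} {f g h : X ⟶ Y}
    (H : StablyZero (h - (f + g))) :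
    T.stageMap k n h ≫ T.transition k n Y =
      (T.stageMap k n f + T.stageMap k n g) ≫ T.transition k n Y := by
  induction k generalizing n X Y with
  | zero =>
    have := T.map_comp_δ_of_stablyZero n H
    rw [Functor.map_sub, Preadditive.sub_comp, sub_eq_zero, Functor.map_add] at this
    exact this
  | succ k ih => exact ih (n + 1) (stablyZero_syzygyMap_add H)

lemma stageMap_comp_transition_of_stably_id (k : ℕ) (n : ℤ) {X : C} {f : X ⟶ X}
    (H : StablyZero (f - 𝟙 X)) :
    T.stageMap k n f ≫ T.transition k n X = T.transition k n X := by
  induction k generalizing n X with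
  | zero =>
    have := T.map_comp_δ_of_stablyZero n H
    rw [Functor.map_sub, Preadditive.sub_comp, sub_eq_zero,
      CategoryTheory.Functor.map_id, Category.id_comp] at this
    exact this
  | succ k ih => exact ih (n + 1) (stablyZero_syzygyMap_sub_id H)

/-- The completed group: the colimit of `Tⁿ⁺ᵏ(Ωᵏ X)` along the connecting homomorphisms. -/
def complObj (n : ℤ) (X : C) : AddCommGrpCat.{w} :=
  colimit (Functor.ofSequence fun k ↦ T.transition k n X)

instance : PreservesFilteredColimitsOfSize.{0, 0} (forget AddCommGrpCat.{w}) :=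
  preservesFilteredColimitsOfSize_shrink.{0, w, 0, w} _

/-- The canonical map from `Tⁿ⁺ᵏ(Ωᵏ X)` to the completed group. -/
def ι (k : ℕ) (n : ℤ) (X : C) : T.stage k n X ⟶ T.complObj n X :=
  colimit.ι (Functor.ofSequence fun k ↦ T.transition k n X) k

lemma transition_comp_ι (k : ℕ) (n : ℤ) (X : C) :
    T.transition k n X ≫ T.ι (k + 1) n X = T.ι k n X := by
  have := colimit.w (Functor.ofSequence fun k ↦ T.transition k n X) (homOfLE (Nat.le_add_right k 1))
  rw [Functor.ofSequence_map_homOfLE_succ] at this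
  exact this

section

variable {T} {n : ℤ} {X : C} {G : AddCommGrpCat.{w}}

lemma complObj_hom_ext {f g : T.complObj n X ⟶ G} (h : ∀ k, T.ι k n X ≫ f = T.ι k n X ≫ g) :
    f = g :=
  colimit.hom_ext h

/-- The map out of the completed group defined by a compatible family of maps. -/
def desc (f : ∀ k, T.stage k n X ⟶ G) (hf : ∀ k, T.transition k n X ≫ f (k + 1) = f k) :
    T.complObj n X ⟶ G :=
  colimit.desc (Functor.ofSequence fun k ↦ T.transition k n X)
    ⟨G, NatTrans.ofSequence f fun k ↦ by
      rw [Functor.ofSequence_map_homOfLE_succ]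
      exact (hf k).trans (Category.comp_id _).symm⟩

@[simp]
lemma ι_desc (f : ∀ k, T.stage k n X ⟶ G) (hf : ∀ k, T.transition k n X ≫ f (k + 1) = f k)
    (k : ℕ) : T.ι k n X ≫ desc f hf = f k :=
  colimit.ι_desc _ _

lemma exists_ι_eq (x : T.complObj n X) : ∃ (k : ℕ) (y : T.stage k n X), T.ι k n X y = x :=
  Concrete.colimit_exists_rep _ x

end

/-- The iterated connecting homomorphism `Tⁿ(X) ⟶ Tⁿ⁺ᵏ(Ωᵏ X)`. -/
def toStage : ∀ (k : ℕ) (n : ℤ) (X : C), (T.T n).obj X ⟶ T.stage k n X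
  | 0, _, _ => 𝟙 _
  | k + 1, n, X => T.δ n (syzygySeq_shortExact X) ≫ toStage k (n + 1) (syzygy X)

lemma toStage_comp_transition (k : ℕ) (n : ℤ) (X : C) :
    T.toStage k n X ≫ T.transition k n X = T.toStage (k + 1) n X := by
  induction k generalizing n X with
  | zero => exact (Category.id_comp _).trans (Category.comp_id _).symm
  | succ k ih => exact (Category.assoc _ _ _).trans (congrArg _ (ih (n + 1) (syzygy X)))

lemma exists_toStage_eq_zero {n : ℤ} {X : C} (x : (T.T n).obj X) (hx : T.ι 0 n X x = 0) :
    ∃ k, T.toStage k n X x = 0 := by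
  let F := Functor.ofSequence fun k ↦ T.transition k n X
  have hF (k : ℕ) : F.map (homOfLE (Nat.zero_le k)) = T.toStage k n X := by
    induction k with
    | zero => exact F.map_id 0
    | succ k ih =>
      rw [← T.toStage_comp_transition, ← ih]
      refine (F.map_comp (homOfLE (Nat.zero_le k)) (homOfLE (Nat.le_add_right k 1))).trans ?_
      exact congrArg _ (Functor.ofSequence_map_homOfLE_succ (fun k ↦ T.transition k n X) k)
  obtain ⟨k, f, g, h⟩ := Concrete.colimit_exists_of_rep_eq F (i := 0) (j := 0) x 0
    (hx.trans (map_zero _).symm)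
  refine ⟨k, ?_⟩
  rw [← hF]
  exact h.trans (map_zero _)

/-- The map induced on completed groups. -/
def complMap (n : ℤ) {X Y : C} (f : X ⟶ Y) : T.complObj n X ⟶ T.complObj n Y :=
  desc (fun k ↦ T.stageMap k n f ≫ T.ι k n Y) fun k ↦ by
    rw [← Category.assoc, transition_naturality, Category.assoc, transition_comp_ι]

@[simp]
lemma ι_complMap (k : ℕ) (n : ℤ) {X Y : C} (f : X ⟶ Y) :
    T.ι k n X ≫ T.complMap n f = T.stageMap k n f ≫ T.ι k n Y :=
  ι_desc _ _ _

lemma complMap_eq_of_stably_eq (n : ℤ) {X Y : C} {f g : X ⟶ Y} (h : StablyZero (f - g)) :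
    T.complMap n f = T.complMap n g :=
  complObj_hom_ext fun k ↦ by
    rw [ι_complMap, ι_complMap, ← transition_comp_ι, ← Category.assoc, ← Category.assoc,
      stageMap_comp_transition_of_stably_eq T k n h]

lemma complMap_comp (n : ℤ) {X Y Z : C} (f : X ⟶ Y) (g : Y ⟶ Z) :
    T.complMap n (f ≫ g) = T.complMap n f ≫ T.complMap n g :=
  complObj_hom_ext fun k ↦ by
    rw [ι_complMap, reassoc_of% T.ι_complMap, ι_complMap, ← transition_comp_ι, ← Category.assoc,
      stageMap_comp_transition_of_stably_comp T k n (stablyZero_of_eq rfl)]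
    simp only [Category.assoc]

lemma complMap_id (n : ℤ) (X : C) : T.complMap n (𝟙 X) = 𝟙 _ :=
  complObj_hom_ext fun k ↦ by
    rw [ι_complMap, ← transition_comp_ι, ← Category.assoc,
      stageMap_comp_transition_of_stably_id T k n (stablyZero_of_eq rfl), Category.comp_id]

lemma complMap_add (n : ℤ) {X Y : C} (f g : X ⟶ Y) :
    T.complMap n (f + g) = T.complMap n f + T.complMap n g :=
  complObj_hom_ext fun k ↦ by
    rw [Preadditive.comp_add, ι_complMap, ι_complMap, ι_complMap, ← Preadditive.add_comp,
      ← transition_comp_ι, ← Category.assoc, ← Category.assoc,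
      stageMap_comp_transition_of_stably_add T k n (stablyZero_of_eq rfl)]

/-- The completed functor in degree `n`. -/
abbrev complFunctor (n : ℤ) : C ⥤ AddCommGrpCat.{w} where
  obj := T.complObj n
  map := T.complMap n
  map_id := T.complMap_id n
  map_comp := T.complMap_comp n

instance (n : ℤ) : (T.complFunctor n).Additive where
  map_add := T.complMap_add n _ _

/-- The canonical map from `T.stage (k + 1) n X`, viewed as the `k`-th group for the syzygy. -/
def ιSyzygy (k : ℕ) (n : ℤ) (X : C) : T.stage (k + 1) n X ⟶ T.complObj (n + 1) (syzygy X) :=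
  T.ι k (n + 1) (syzygy X)

lemma transition_comp_ιSyzygy (k : ℕ) (n : ℤ) (X : C) :
    T.transition (k + 1) n X ≫ T.ιSyzygy (k + 1) n X = T.ιSyzygy k n X :=
  T.transition_comp_ι k (n + 1) (syzygy X)

lemma ιSyzygy_complMap (k : ℕ) (n : ℤ) {X Y : C} (f : X ⟶ Y) :
    T.ιSyzygy k n X ≫ T.complMap (n + 1) (syzygyMap f) =
      T.stageMap (k + 1) n f ≫ T.ιSyzygy k n Y :=
  T.ι_complMap k (n + 1) (syzygyMap f)

/-- The map `complObj n X ⟶ complObj (n + 1) (syzygy X)` given by connecting homomorphisms. -/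
def shiftHom (n : ℤ) (X : C) : T.complObj n X ⟶ T.complObj (n + 1) (syzygy X) :=
  desc (fun k ↦ T.transition k n X ≫ T.ιSyzygy k n X) fun k ↦ by rw [transition_comp_ιSyzygy]

lemma ι_shiftHom (k : ℕ) (n : ℤ) (X : C) :
    T.ι k n X ≫ T.shiftHom n X = T.transition k n X ≫ T.ιSyzygy k n X :=
  ι_desc _ _ _

lemma ι_succ_shiftHom (k : ℕ) (n : ℤ) (X : C) :
    T.ι (k + 1) n X ≫ T.shiftHom n X = T.ιSyzygy k n X := by
  rw [ι_shiftHom, transition_comp_ιSyzygy]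

/-- The inverse of `shiftHom`. -/
def shiftInv (n : ℤ) (X : C) : T.complObj (n + 1) (syzygy X) ⟶ T.complObj n X :=
  desc (fun k ↦ T.ι (k + 1) n X) fun k ↦ T.transition_comp_ι (k + 1) n X

lemma ιSyzygy_shiftInv (k : ℕ) (n : ℤ) (X : C) :
    T.ιSyzygy k n X ≫ T.shiftInv n X = T.ι (k + 1) n X :=
  ι_desc (n := n + 1) (X := syzygy X) (fun k ↦ T.ι (k + 1) n X)
    (fun k ↦ T.transition_comp_ι (k + 1) n X) k

/-- Dropping the first group of the sequence defining the completion does not change the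
colimit. -/
instance (n : ℤ) (X : C) : IsIso (T.shiftHom n X) := by
  refine ⟨T.shiftInv n X, complObj_hom_ext fun k ↦ ?_, complObj_hom_ext fun k ↦ ?_⟩
  · rw [reassoc_of% T.ι_shiftHom, ιSyzygy_shiftInv, transition_comp_ι, Category.comp_id]
  · change T.ιSyzygy k n X ≫ _ = T.ιSyzygy k n X ≫ _
    rw [reassoc_of% T.ιSyzygy_shiftInv, ι_succ_shiftHom, Category.comp_id]

lemma shiftHom_naturality (n : ℤ) {X Y : C} (f : X ⟶ Y) :
    T.complMap n f ≫ T.shiftHom n Y = T.shiftHom n X ≫ T.complMap (n + 1) (syzygyMap f) :=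
  complObj_hom_ext fun k ↦ by
    rw [reassoc_of% T.ι_complMap, ι_shiftHom, reassoc_of% T.ι_shiftHom, ιSyzygy_complMap,
      ← Category.assoc, ← Category.assoc, transition_naturality]

/-- The connecting homomorphism of the completion. -/
def complδ (n : ℤ) {S : ShortComplex C} (hS : S.ShortExact) :
    T.complObj n S.X₃ ⟶ T.complObj (n + 1) S.X₁ :=
  T.shiftHom n S.X₃ ≫ T.complMap (n + 1) (fromSyzygySeq hS).τ₁

lemma complδ_naturality (n : ℤ) {S S' : ShortComplex C} (hS : S.ShortExact) (hS' : S'.ShortExact)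
    (φ : S ⟶ S') :
    T.complMap n φ.τ₃ ≫ T.complδ n hS' = T.complδ n hS ≫ T.complMap (n + 1) φ.τ₁ := by
  rw [complδ, complδ, ← Category.assoc, shiftHom_naturality, Category.assoc, Category.assoc,
    ← complMap_comp, ← complMap_comp]
  congr 1
  apply complMap_eq_of_stably_eq
  exact stablyZero_τ₁ (S := syzygySeq S.X₃) hS'
    (syzygySeqMap φ.τ₃ ≫ fromSyzygySeq hS' - fromSyzygySeq hS ≫ φ)
    (by simpa using stablyZero_zero _ _)

/-- The connecting homomorphism of a sequence with projective middle term is invertible, since its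
first term is stably isomorphic to the syzygy of the third term. -/
instance isIso_complδ (n : ℤ) {S : ShortComplex C} (hS : S.ShortExact) [Projective S.X₂] :
    IsIso (T.complδ n hS) := by
  obtain ⟨ψ, hψ⟩ := exists_hom_of_projective (S := S) (syzygySeq_shortExact S.X₃) (𝟙 S.X₃)
  have : IsIso (T.complMap (n + 1) (fromSyzygySeq hS).τ₁) := by
    refine ⟨T.complMap (n + 1) ψ.τ₁, ?_, ?_⟩
    · rw [← complMap_comp, ← complMap_id]
      apply complMap_eq_of_stably_eq
      exact stablyZero_τ₁ (S := syzygySeq S.X₃) (syzygySeq_shortExact S.X₃)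
        (fromSyzygySeq hS ≫ ψ - 𝟙 _) (by simpa [hψ] using stablyZero_zero _ _)
    · rw [← complMap_comp, ← complMap_id]
      apply complMap_eq_of_stably_eq
      exact stablyZero_τ₁ (S := S) hS
        (ψ ≫ fromSyzygySeq hS - 𝟙 _) (by simpa [hψ] using stablyZero_zero _ _)
  unfold complδ
  infer_instance

lemma complδ_syzygySeq (n : ℤ) (X : C) :
    T.complδ n (syzygySeq_shortExact X) = T.shiftHom n X := by
  have : T.complMap (n + 1) (fromSyzygySeq (syzygySeq_shortExact X)).τ₁ = 𝟙 _ := by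
    rw [← complMap_id]
    apply complMap_eq_of_stably_eq
    exact stablyZero_τ₁ (S := syzygySeq X) (syzygySeq_shortExact X)
      (fromSyzygySeq (syzygySeq_shortExact X) - 𝟙 _) (by simpa using stablyZero_zero _ _)
  exact (congrArg _ this).trans (Category.comp_id _)

/-- The canonical map to the completion. -/
def toCompl (n : ℤ) : T.T n ⟶ T.complFunctor n where
  app X := T.ι 0 n X
  naturality _ _ f := (T.ι_complMap 0 n f).symm

/-- The canonical map to the completion commutes with connecting homomorphisms. -/
lemma toCompl_comp_complδ (n : ℤ) {S : ShortComplex C} (hS : S.ShortExact) :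
    (T.toCompl n).app S.X₃ ≫ T.complδ n hS = T.δ n hS ≫ (T.toCompl (n + 1)).app S.X₁ := by
  have := T.δ_naturality n (syzygySeq_shortExact S.X₃) hS (fromSyzygySeq hS)
  rw [fromSyzygySeq_τ₃, CategoryTheory.Functor.map_id, Category.id_comp] at this
  rw [this, Category.assoc, (T.toCompl (n + 1)).naturality]
  exact (reassoc_of% T.ι_shiftHom 0 n S.X₃) _

lemma isZero_complObj (n : ℤ) (P : C) [Projective P] : IsZero (T.complObj n P) := by
  rw [IsZero.iff_id_eq_zero, ← complMap_id]
  exact (T.complMap_eq_of_stably_eq n (stablyZero_of_projective _)).trans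
    ((T.complFunctor n).map_zero P P)

end CohomologicalFunctor

end Completion

section Exactness

variable {C : Type u} [Category.{v} C] [Abelian C]

namespace CohomologicalFunctor

lemma VanishesOnProjectives.isIso_δ {D : Type*} [Category* D] [Abelian D]
    {U : CohomologicalFunctor C D} (hU : U.VanishesOnProjectives)
    (n : ℤ) {S : ShortComplex C} (hS : S.ShortExact) [Projective S.X₂] : IsIso (U.δ n hS) := by
  have h₁ := (ShortComplex.exact_iff_epi _ ((hU (n + 1) S.X₂ inferInstance).eq_of_tgt _ _)).1
    (U.exact₁ n hS)
  have h₃ := (ShortComplex.exact_iff_mono _ ((hU n S.X₂ inferInstance).eq_of_src _ _)).1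
    (U.exact₃ n hS)
  dsimp only at h₁ h₃
  exact isIso_of_mono_of_epi _

variable [EnoughProjectives C]

variable (T : CohomologicalFunctor C AddCommGrpCat.{w})

/-! ### Exactness of the completion -/

lemma complMap_f_comp_complMap_g (n : ℤ) (S : ShortComplex C) :
    T.complMap n S.f ≫ T.complMap n S.g = 0 := by
  rw [← complMap_comp, S.zero]
  exact (T.complFunctor n).map_zero _ _

lemma complMap_eq_zero_of_stablyZero (n : ℤ) {X Y : C} {f : X ⟶ Y} (h : StablyZero f) :
    T.complMap n f = 0 :=
  (T.complMap_eq_of_stably_eq n ((sub_zero f).symm ▸ h)).trans ((T.complFunctor n).map_zero X Y)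

lemma complδ_comp_complMap_f (n : ℤ) {S : ShortComplex C} (hS : S.ShortExact) :
    T.complδ n hS ≫ T.complMap (n + 1) S.f = 0 := by
  have : StablyZero ((fromSyzygySeq hS).τ₁ ≫ S.f) :=
    ⟨Projective.over S.X₃, inferInstance, kernel.ι _, (fromSyzygySeq hS).τ₂,
      (fromSyzygySeq hS).comm₁₂.symm⟩
  rw [complδ, Category.assoc, ← complMap_comp, T.complMap_eq_zero_of_stablyZero _ this, comp_zero]

lemma complMap_g_comp_complδ (n : ℤ) {S : ShortComplex C} (hS : S.ShortExact) :
    T.complMap n S.g ≫ T.complδ n hS = 0 := by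
  let ψ : syzygySeq S.X₂ ⟶ S := { τ₁ := 0, τ₂ := Projective.π S.X₂, τ₃ := S.g }
  have : StablyZero (syzygyMap S.g ≫ (fromSyzygySeq hS).τ₁) := by
    simpa [ψ, syzygyMap] using stablyZero_τ₁ (S := syzygySeq S.X₂) hS
      (syzygySeqMap S.g ≫ fromSyzygySeq hS - ψ) (by simpa [ψ] using stablyZero_zero _ _)
  rw [complδ, ← Category.assoc, shiftHom_naturality, Category.assoc, ← complMap_comp,
    T.complMap_eq_zero_of_stablyZero _ this, comp_zero]

/-- Exactness at the middle term can be checked after passing to syzygies. -/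
lemma exists_complMap_eq_of_horseshoe {n : ℤ} {S : ShortComplex C} (hS : S.ShortExact)
    (y : T.complObj n S.X₂) (x : T.complObj (n + 1) (horseshoe hS).X₁)
    (h : T.complMap (n + 1) (horseshoe hS).f x =
      T.complδ n (middleSyzygySeq_shortExact hS) y) :
    ∃ x, T.complMap n S.f x = y := by
  have : Function.Bijective (T.complδ n (syzygySeq_shortExact S.X₁)) :=
    ConcreteCategory.bijective_of_isIso _
  obtain ⟨x, rfl⟩ := this.2 x
  have : Function.Bijective (T.complδ n (middleSyzygySeq_shortExact hS)) :=
    ConcreteCategory.bijective_of_isIso _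
  refine ⟨x, this.1 ?_⟩
  rw [← h]
  exact ConcreteCategory.congr_hom (T.complδ_naturality n (syzygySeq_shortExact S.X₁)
    (middleSyzygySeq_shortExact hS) (toMiddleSyzygySeq hS)) x

lemma exists_complMap_eq_of_toStage (k : ℕ) {n : ℤ} {S : ShortComplex C} (hS : S.ShortExact)
    (y : (T.T n).obj S.X₂) (hy : T.toStage k n S.X₃ ((T.T n).map S.g y) = 0) :
    ∃ x, T.complMap n S.f x = (T.toCompl n).app S.X₂ y := by
  induction k generalizing n S with
  | zero =>
    obtain ⟨x, rfl⟩ := (ShortComplex.ab_exact_iff _).1 (T.exact₂ n hS) y hy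
    exact ⟨(T.toCompl n).app S.X₁ x,
      (ConcreteCategory.congr_hom ((T.toCompl n).naturality S.f) x).symm⟩
  | succ k ih =>
    obtain ⟨x, hx⟩ := ih (horseshoe_shortExact hS) (T.δ n (middleSyzygySeq_shortExact hS) y) (by
      refine Eq.trans ?_ hy
      exact congrArg (T.toStage k (n + 1) (syzygy S.X₃)) (ConcreteCategory.congr_hom
        (T.δ_naturality n (middleSyzygySeq_shortExact hS) (syzygySeq_shortExact S.X₃)
          (fromMiddleSyzygySeq hS)) y).symm)
    refine T.exists_complMap_eq_of_horseshoe hS _ x (hx.trans ?_)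
    exact (ConcreteCategory.congr_hom
      (T.toCompl_comp_complδ n (middleSyzygySeq_shortExact hS)) y).symm

lemma exists_complMap_eq_of_stage (k : ℕ) {n : ℤ} {S : ShortComplex C} (hS : S.ShortExact)
    (y : T.stage k n S.X₂) (hy : T.complMap n S.g (T.ι k n S.X₂ y) = 0) :
    ∃ x, T.complMap n S.f x = T.ι k n S.X₂ y := by
  induction k generalizing n S with
  | zero =>
    have h := ConcreteCategory.congr_hom (T.ι_complMap 0 n S.g) y
    obtain ⟨k, hk⟩ := T.exists_toStage_eq_zero _ (h.symm.trans hy)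
    exact T.exists_complMap_eq_of_toStage k hS y hk
  | succ k ih =>
    let hM := middleSyzygySeq_shortExact hS
    have h : T.complδ n hM (T.ι (k + 1) n S.X₂ y) =
        T.ι k (n + 1) _ (T.stageMap k (n + 1) (fromSyzygySeq hM).τ₁ y) :=
      (congrArg (T.complMap (n + 1) (fromSyzygySeq hM).τ₁)
        (ConcreteCategory.congr_hom (T.ι_succ_shiftHom k n S.X₂) y)).trans
        (ConcreteCategory.congr_hom (T.ι_complMap k (n + 1) (fromSyzygySeq hM).τ₁) y)
    obtain ⟨x, hx⟩ := ih (horseshoe_shortExact hS)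
      (T.stageMap k (n + 1) (fromSyzygySeq hM).τ₁ y) (by
        refine (congrArg _ h.symm).trans ?_
        refine (ConcreteCategory.congr_hom (T.complδ_naturality n hM
          (syzygySeq_shortExact S.X₃) (fromMiddleSyzygySeq hS)) _).symm.trans ?_
        exact (congrArg (T.complδ n (syzygySeq_shortExact S.X₃)) hy).trans (map_zero _))
    exact T.exists_complMap_eq_of_horseshoe hS _ x (hx.trans h.symm)

lemma exists_complMap_f_eq (n : ℤ) {S : ShortComplex C} (hS : S.ShortExact)
    (y : T.complObj n S.X₂) (hy : T.complMap n S.g y = 0) : ∃ x, T.complMap n S.f x = y := by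
  obtain ⟨k, y, rfl⟩ := exists_ι_eq y
  exact T.exists_complMap_eq_of_stage k hS y hy

lemma complMap_comp_apply (n : ℤ) {X Y Z : C} (f : X ⟶ Y) (g : Y ⟶ Z) (x : T.complObj n X) :
    T.complMap n (f ≫ g) x = T.complMap n g (T.complMap n f x) :=
  ConcreteCategory.congr_hom (T.complMap_comp n f g) x

lemma complMap_neg (n : ℤ) {X Y : C} (f : X ⟶ Y) : T.complMap n (-f) = -T.complMap n f :=
  (T.complFunctor n).map_neg

/-- Exactness at the first term is exactness at the middle term of the rotated sequence. -/
lemma exists_complδ_eq (n : ℤ) {S : ShortComplex C} (hS : S.ShortExact)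
    (x : T.complObj (n + 1) S.X₁) (hx : T.complMap (n + 1) S.f x = 0) :
    ∃ z, T.complδ n hS z = x := by
  obtain ⟨w, hw⟩ := T.exists_complMap_f_eq (n + 1) (rotate_shortExact hS)
    (T.complMap (n + 1) biprod.inl x) (by rw [← complMap_comp_apply, biprod.inl_desc, hx])
  obtain ⟨z, rfl⟩ := (ConcreteCategory.bijective_of_isIso (T.shiftHom n S.X₃)).2 w
  refine ⟨-z, ?_⟩
  have h := congrArg (T.complMap (n + 1) biprod.fst) hw
  rw [← complMap_comp_apply, ← complMap_comp_apply, biprod.inl_fst, biprod.lift_fst, complMap_id,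
    complMap_neg] at h
  rw [map_neg]
  exact h

/-- Exactness at the third term is exactness at the first term of the rotated sequence. -/
lemma exists_complMap_g_eq (n : ℤ) {S : ShortComplex C} (hS : S.ShortExact)
    (z : T.complObj n S.X₃) (hz : T.complδ n hS z = 0) : ∃ y, T.complMap n S.g y = z := by
  have hf : T.complMap (n + 1) (rotate hS).f =
      T.complMap (n + 1) ((-(fromSyzygySeq hS).τ₁) ≫ biprod.inl) :=
    T.complMap_eq_of_stably_eq _
      ⟨Projective.over S.X₃, inferInstance, kernel.ι _, biprod.inr, by
        apply biprod.hom_ext <;> simp⟩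
  obtain ⟨y, hy⟩ := T.exists_complδ_eq n (rotate_shortExact hS) (T.shiftHom n S.X₃ z) (by
    rw [hf]
    refine (T.complMap_comp_apply (n + 1) (-(fromSyzygySeq hS).τ₁) biprod.inl _).trans ?_
    rw [complMap_neg]
    refine (congrArg (T.complMap (n + 1) biprod.inl) ?_).trans (map_zero _)
    exact neg_eq_zero.2 hz)
  refine ⟨y, (ConcreteCategory.bijective_of_isIso (T.shiftHom n S.X₃)).1 ?_⟩
  have h := ConcreteCategory.congr_hom (T.complδ_naturality n (rotate_shortExact hS)
    (syzygySeq_shortExact S.X₃) (rotateHom hS)) y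
  rw [complδ_syzygySeq, complMap_id] at h
  exact h.trans hy

/-- The completion of a cohomological functor with values in abelian groups. -/
abbrev completion : CohomologicalFunctor C AddCommGrpCat.{w} where
  T := T.complFunctor
  additive _ := inferInstance
  δ := T.complδ
  δ_naturality := T.complδ_naturality
  map_g_comp_δ := T.complMap_g_comp_complδ
  δ_comp_map_f := T.complδ_comp_complMap_f
  map_f_comp_map_g n S _ := T.complMap_f_comp_complMap_g n S
  exact₁ n _ hS := (ShortComplex.ab_exact_iff _).2 (T.exists_complδ_eq n hS)
  exact₂ n _ hS := (ShortComplex.ab_exact_iff _).2 (T.exists_complMap_f_eq n hS)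
  exact₃ n _ hS := (ShortComplex.ab_exact_iff _).2 (T.exists_complMap_g_eq n hS)

/-! ### The universal property -/

/-- The canonical morphism to the completion. -/
abbrev completionHom : T.Hom T.completion where
  app := T.toCompl
  comm n _ hS := (T.toCompl_comp_complδ n hS).symm

variable {T}

variable {U : CohomologicalFunctor C AddCommGrpCat.{w}} (hU : U.VanishesOnProjectives)
  (f : T.Hom U)

/-- The map `Tⁿ⁺ᵏ(Ωᵏ X) ⟶ Uⁿ⁺ᵏ(Ωᵏ X) ≅ Uⁿ(X)` induced by a morphism from `T` to a cohomological
functor `U` that vanishes on projectives. -/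
def stageDesc : ∀ (k : ℕ) (n : ℤ) (X : C), T.stage k n X ⟶ (U.T n).obj X
  | 0, n, X => (f.app n).app X
  | k + 1, n, X =>
    letI := hU.isIso_δ n (syzygySeq_shortExact X)
    stageDesc k (n + 1) (syzygy X) ≫ inv (U.δ n (syzygySeq_shortExact X))

/-- The map `stageDesc` for the syzygy, on the corresponding group for the object itself. -/
def stageDescSyzygy (k : ℕ) (n : ℤ) (X : C) :
    T.stage (k + 1) n X ⟶ (U.T (n + 1)).obj (syzygy X) :=
  stageDesc hU f k (n + 1) (syzygy X)

lemma stageDesc_succ_comp_δ (k : ℕ) (n : ℤ) (X : C) :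
    stageDesc hU f (k + 1) n X ≫ U.δ n (syzygySeq_shortExact X) = stageDescSyzygy hU f k n X := by
  have := hU.isIso_δ n (syzygySeq_shortExact X)
  exact (Category.assoc _ _ _).trans ((congrArg _ (IsIso.inv_hom_id _)).trans (Category.comp_id _))

lemma transition_comp_stageDescSyzygy (k : ℕ) (n : ℤ) (X : C) :
    T.transition k n X ≫ stageDescSyzygy hU f k n X =
      stageDesc hU f k n X ≫ U.δ n (syzygySeq_shortExact X) := by
  induction k generalizing n X with
  | zero => exact f.comm n (syzygySeq_shortExact X)
  | succ k ih =>
    rw [stageDesc_succ_comp_δ]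
    have h : T.transition k (n + 1) (syzygy X) ≫ stageDesc hU f (k + 1) (n + 1) (syzygy X) =
        stageDesc hU f k (n + 1) (syzygy X) := by
      have := hU.isIso_δ (n + 1) (syzygySeq_shortExact (syzygy X))
      rw [← cancel_mono (U.δ (n + 1) (syzygySeq_shortExact (syzygy X))), Category.assoc,
        stageDesc_succ_comp_δ, ih]
    exact h

lemma transition_comp_stageDesc (k : ℕ) (n : ℤ) (X : C) :
    T.transition k n X ≫ stageDesc hU f (k + 1) n X = stageDesc hU f k n X := by
  have := hU.isIso_δ n (syzygySeq_shortExact X)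
  rw [← cancel_mono (U.δ n (syzygySeq_shortExact X)), Category.assoc, stageDesc_succ_comp_δ,
    transition_comp_stageDescSyzygy]

lemma stageMap_comp_stageDesc (k : ℕ) (n : ℤ) {X Y : C} (g : X ⟶ Y) :
    T.stageMap k n g ≫ stageDesc hU f k n Y = stageDesc hU f k n X ≫ (U.T n).map g := by
  induction k generalizing n X Y with
  | zero => exact (f.app n).naturality g
  | succ k ih =>
    have := hU.isIso_δ n (syzygySeq_shortExact Y)
    have h := U.δ_naturality n (syzygySeq_shortExact X) (syzygySeq_shortExact Y) (syzygySeqMap g)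
    rw [syzygySeqMap_τ₃] at h
    rw [← cancel_mono (U.δ n (syzygySeq_shortExact Y)), Category.assoc, Category.assoc,
      stageDesc_succ_comp_δ, h, ← Category.assoc, stageDesc_succ_comp_δ]
    exact ih (n + 1) (syzygyMap g)

/-- The natural transformation out of the completed functor induced by `f`. -/
def complDesc (n : ℤ) : T.complFunctor n ⟶ U.T n where
  app X := desc (fun k ↦ stageDesc hU f k n X) fun k ↦ transition_comp_stageDesc hU f k n X
  naturality X Y g := complObj_hom_ext fun k ↦ by
    rw [reassoc_of% T.ι_complMap, ι_desc, stageMap_comp_stageDesc, ← Category.assoc, ι_desc]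

lemma ι_complDesc_app (k : ℕ) (n : ℤ) (X : C) :
    T.ι k n X ≫ (complDesc hU f n).app X = stageDesc hU f k n X :=
  ι_desc _ (fun k ↦ transition_comp_stageDesc hU f k n X) k

lemma shiftHom_comp_complDesc_app (n : ℤ) (X : C) :
    T.shiftHom n X ≫ (complDesc hU f (n + 1)).app (syzygy X) =
      (complDesc hU f n).app X ≫ U.δ n (syzygySeq_shortExact X) :=
  complObj_hom_ext fun k ↦ by
    have h : T.ιSyzygy k n X ≫ (complDesc hU f (n + 1)).app (syzygy X) =
        stageDesc hU f (k + 1) n X ≫ U.δ n (syzygySeq_shortExact X) := by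
      rw [stageDesc_succ_comp_δ]
      exact ι_complDesc_app hU f k (n + 1) (syzygy X)
    rw [reassoc_of% T.ι_shiftHom, h, ← Category.assoc, ← Category.assoc, transition_comp_stageDesc,
      ι_complDesc_app]

/-- The morphism out of the completion induced by a morphism to a cohomological functor that
vanishes on projectives. -/
abbrev completionDesc : T.completion.Hom U where
  app := complDesc hU f
  comm n S hS := by
    have h := U.δ_naturality n (syzygySeq_shortExact S.X₃) hS (fromSyzygySeq hS)
    rw [fromSyzygySeq_τ₃, CategoryTheory.Functor.map_id, Category.id_comp] at h
    change (T.shiftHom n S.X₃ ≫ T.complMap (n + 1) (fromSyzygySeq hS).τ₁) ≫ _ = _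
    rw [h, ← Category.assoc, ← shiftHom_comp_complDesc_app, Category.assoc, Category.assoc]
    exact congrArg _ ((complDesc hU f (n + 1)).naturality (fromSyzygySeq hS).τ₁)

/-- A morphism out of the completion is determined on the image of `Tⁿ⁺ᵏ(Ωᵏ X)` by its values on
the image of `Tⁿ⁺ᵏ⁺¹(Ωᵏ⁺¹ X)`, since connecting homomorphisms to syzygies are invertible. -/
lemma ι_comp_app_eq_stageDesc (g : T.completion.Hom U) (hg : T.completionHom.comp g = f)
    (k : ℕ) (n : ℤ) (X : C) : T.ι k n X ≫ (g.app n).app X = stageDesc hU f k n X := by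
  induction k generalizing n X with
  | zero =>
    subst hg
    rfl
  | succ k ih =>
    have := hU.isIso_δ n (syzygySeq_shortExact X)
    have h := g.comm n (syzygySeq_shortExact X)
    change T.complδ n (syzygySeq_shortExact X) ≫ _ = _ at h
    rw [complδ_syzygySeq] at h
    rw [← cancel_mono (U.δ n (syzygySeq_shortExact X)), stageDesc_succ_comp_δ, Category.assoc,
      ← h, reassoc_of% T.ι_succ_shiftHom]
    exact ih (n + 1) (syzygy X)

variable (T) in
/-- The completion is a Mislin completion. -/
def mislinCompletion : MislinCompletion T where
  functor := T.completion
  ν := T.completionHom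
  vanishesOnProjectives n P _ := T.isZero_complObj n P
  existsUnique_fac U hU f := by
    refine ⟨completionDesc hU f, ?_, fun g hg ↦ ?_⟩
    · apply CohomologicalFunctor.Hom.ext
      funext n
      apply NatTrans.ext
      funext X
      exact ι_complDesc_app hU f 0 n X
    · apply CohomologicalFunctor.Hom.ext
      funext n
      apply NatTrans.ext
      funext X
      exact complObj_hom_ext fun k ↦
        (ι_comp_app_eq_stageDesc hU f g hg k n X).trans (ι_complDesc_app hU f k n X).symm

end CohomologicalFunctor

lemma CohomologicalFunctor.Hom.comp_assoc {D : Type*} [Category* D] [Abelian D]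
    {T U V W : CohomologicalFunctor C D}
    (f : T.Hom U) (g : U.Hom V) (h : V.Hom W) : (f.comp g).comp h = f.comp (g.comp h) := by
  ext
  simp [comp]

/-- Any two Mislin completions have isomorphic values. -/
lemma MislinCompletion.nonempty_iso {D : Type*} [Category* D] [Abelian D]
    {T : CohomologicalFunctor C D} (M M' : MislinCompletion T) (n : ℤ) (X : C) :
    Nonempty ((M.functor.T n).obj X ≅ (M'.functor.T n).obj X) := by
  obtain ⟨a, ha, -⟩ := M.existsUnique_fac _ M'.vanishesOnProjectives M'.ν
  obtain ⟨b, hb, -⟩ := M'.existsUnique_fac _ M.vanishesOnProjectives M.ν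
  let i (U : CohomologicalFunctor C D) : U.Hom U := ⟨fun _ ↦ 𝟙 _, fun n S hS ↦ by simp⟩
  have hi {U V : CohomologicalFunctor C D} (f : U.Hom V) : f.comp (i V) = f := by
    ext
    simp [CohomologicalFunctor.Hom.comp, i]
  have hab : a.comp b = i _ :=
    (M.existsUnique_fac _ M.vanishesOnProjectives M.ν).unique
      (by rw [← CohomologicalFunctor.Hom.comp_assoc, ha, hb]) (hi _)
  have hba : b.comp a = i _ :=
    (M'.existsUnique_fac _ M'.vanishesOnProjectives M'.ν).unique
      (by rw [← CohomologicalFunctor.Hom.comp_assoc, hb, ha]) (hi _)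
  exact ⟨⟨(a.app n).app X, (b.app n).app X,
    congrArg (fun f : M.functor.Hom _ ↦ (f.app n).app X) hab,
    congrArg (fun f : M'.functor.Hom _ ↦ (f.app n).app X) hba⟩⟩

end Exactness

/-! ### Finite projective dimension -/

section ProjectiveDimension

open Abelian

variable {C : Type u} [Category.{v} C] [Abelian C]

/-- Splicing a short exact sequence with projective middle term to a projective resolution of its
first term. -/
def splice {S : ShortComplex C} (hS : S.ShortExact) [Projective S.X₂]
    (P : ProjectiveResolution S.X₁) : ProjectiveResolution S.X₃ :=
  let p : P.complex.X 0 ⟶ S.X₁ := P.π.f 0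
  have hp : P.complex.d 1 0 ≫ p = 0 := P.complex_d_comp_π_f_zero
  have hw : P.complex.d 1 0 ≫ p ≫ S.f = 0 := by rw [← Category.assoc, hp, zero_comp]
  have hg : (p ≫ S.f) ≫ S.g = 0 := by rw [Category.assoc, S.zero, comp_zero]
  { complex := P.complex.augment (p ≫ S.f) hw
    projective := by
      rintro (_ | n)
      · assumption
      · exact P.projective n
    π := (ChainComplex.toSingle₀Equiv _ _).symm ⟨S.g, hg⟩
    quasiIso := ⟨fun n ↦ by
      have := hS.mono_f
      have := hS.epi_g
      obtain _ | n := n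
      · rw [ChainComplex.quasiIsoAt₀_iff, ShortComplex.quasiIso_iff_of_zeros']
        · let φ : ShortComplex.mk _ _ hg ⟶ S := { τ₁ := p, τ₂ := 𝟙 _, τ₃ := 𝟙 _ }
          have : Epi φ.τ₁ := inferInstanceAs (Epi (P.π.f 0))
          have : IsIso φ.τ₂ := inferInstanceAs (IsIso (𝟙 _))
          have : Mono φ.τ₃ := inferInstanceAs (Mono (𝟙 _))
          have hπ : ((ChainComplex.toSingle₀Equiv (P.complex.augment (p ≫ S.f) hw) _).symm
              ⟨S.g, hg⟩).f 0 = S.g := ChainComplex.toSingle₀Equiv_symm_apply_f_zero _ _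
          refine (ShortComplex.exact_and_epi_g_iff_of_iso ?_).2
            ⟨(ShortComplex.exact_iff_of_epi_of_isIso_of_mono φ).2 hS.exact, hS.epi_g⟩
          exact ShortComplex.isoMk (Iso.refl _) (Iso.refl _) (Iso.refl _)
            ((Category.id_comp _).trans (Category.comp_id _).symm)
            ((Category.id_comp _).trans (hπ.symm.trans (Category.comp_id _).symm))
        all_goals rfl
      · rw [quasiIsoAt_iff_exactAt' _ _ (ChainComplex.exactAt_succ_single_obj _ _),
          HomologicalComplex.exactAt_iff' _ (n + 2) (n + 1) n (by simp) (by simp)]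
        obtain _ | n := n
        · let φ : ShortComplex.mk _ _ hp ⟶ ShortComplex.mk _ _ hw :=
            { τ₁ := 𝟙 _, τ₂ := 𝟙 _, τ₃ := S.f }
          have : Epi φ.τ₁ := inferInstanceAs (Epi (𝟙 _))
          have : IsIso φ.τ₂ := inferInstanceAs (IsIso (𝟙 _))
          have : Mono φ.τ₃ := inferInstanceAs (Mono S.f)
          exact (ShortComplex.exact_iff_of_epi_of_isIso_of_mono φ).1 P.exact₀
        · exact P.exact_succ n⟩ }

/-- An object of finite projective dimension in terms of Ext groups admits a projective resolution
of finite length, by dimension shifting along syzygies. -/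
lemma hasFiniteProjectiveDimension_of_hasProjectiveDimensionLT [EnoughProjectives C] (n : ℕ)
    (X : C) [HasProjectiveDimensionLT X n] : HasFiniteProjectiveDimension X := by
  induction n generalizing X with
  | zero =>
    have : Projective X := (isZero_of_hasProjectiveDimensionLT_zero X).projective
    exact ⟨.self X, 0, fun n hn ↦ HomologicalComplex.isZero_single_obj_X _ _ _ _ hn.ne'⟩
  | succ n ih =>
    obtain _ | n := n
    · have : Projective X := projective_iff_hasProjectiveDimensionLT_one.2 ‹_›
      exact ⟨.self X, 0, fun n hn ↦ HomologicalComplex.isZero_single_obj_X _ _ _ _ hn.ne'⟩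
    · have hS := syzygySeq_shortExact X
      have := (hS.hasProjectiveDimensionLT_X₃_iff n inferInstance).1 ‹_›
      obtain ⟨P, N, hP⟩ := ih (syzygy X)
      refine ⟨splice hS P, N + 1, ?_⟩
      rintro (_ | m) hm
      · simp at hm
      · exact hP m (by lia)

lemma HasFiniteProjectiveDimension.exists_hasProjectiveDimensionLT {X : C}
    (h : HasFiniteProjectiveDimension X) : ∃ n, HasProjectiveDimensionLT X n := by
  let := HasExt.standard C
  obtain ⟨P, N, hP⟩ := h
  refine ⟨N + 1, HasProjectiveDimensionLT.mk fun i hi Y e ↦ ?_⟩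
  obtain ⟨f, hf, rfl⟩ := P.extMk_surjective e (i + 1) rfl
  obtain rfl := (hP i hi).eq_of_src f 0
  simp

lemma isZero_extFunctorInt [HasExt.{w} C] (A : C) (N : ℕ) [HasProjectiveDimensionLT A N]
    (n : ℤ) (hn : N ≤ n) (X : C) : IsZero ((extFunctorInt A n).obj X) := by
  obtain ⟨m, rfl⟩ := Int.eq_ofNat_of_zero_le (by lia : 0 ≤ n)
  have := HasProjectiveDimensionLT.subsingleton.{w} A N m (by lia) X
  exact AddCommGrpCat.isZero_of_subsingleton (AddCommGrpCat.of (Ext A X m))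

variable [EnoughProjectives C]

lemma CohomologicalFunctor.VanishesOnProjectives.isZero_of_hasProjectiveDimensionLT
    {D : Type*} [Category* D] [Abelian D] {U : CohomologicalFunctor C D}
    (hU : U.VanishesOnProjectives) (k : ℕ) (n : ℤ) (X : C) [HasProjectiveDimensionLT X k] :
    IsZero ((U.T n).obj X) := by
  induction k generalizing n X with
  | zero => exact hU n X (isZero_of_hasProjectiveDimensionLT_zero X).projective
  | succ k ih =>
    obtain _ | k := k
    · exact hU n X (projective_iff_hasProjectiveDimensionLT_one.2 ‹_›)
    · have hS := syzygySeq_shortExact X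
      have := (hS.hasProjectiveDimensionLT_X₃_iff k inferInstance).1 ‹_›
      exact (U.exact₃ n hS).isZero_of_both_zeros
        ((hU n (Projective.over X) inferInstance).eq_of_src _ _)
        ((ih (n + 1) (syzygy X)).eq_of_tgt _ _)

namespace CohomologicalFunctor

variable {T : CohomologicalFunctor C AddCommGrpCat.{w}}

lemma isZero_stage {N : ℤ} (hT : ∀ n, N ≤ n → ∀ X, IsZero ((T.T n).obj X)) (k : ℕ) (n : ℤ)
    (h : N ≤ n + k) (X : C) : IsZero (T.stage k n X) := by
  induction k generalizing n X with
  | zero => exact hT n (by simpa using h) X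
  | succ k ih => exact ih (n + 1) (by lia) (syzygy X)

/-- The completion of a cohomological functor which vanishes in high degrees is zero. -/
lemma isZero_complObj_of_isZero_above {N : ℤ}
    (hT : ∀ n, N ≤ n → ∀ X, IsZero ((T.T n).obj X)) (n : ℤ) (X : C) :
    IsZero (T.complObj n X) := by
  have h (j k : ℕ) (hk : N ≤ n + k + j) : T.ι k n X = 0 := by
    induction j generalizing k with
    | zero => exact (isZero_stage hT k n (by simpa using hk) X).eq_of_src _ _
    | succ j ih => rw [← transition_comp_ι, ih (k + 1) (by lia), comp_zero]
  rw [IsZero.iff_id_eq_zero]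
  exact complObj_hom_ext fun k ↦ by rw [h (N - n).toNat k (by lia), zero_comp, zero_comp]

end CohomologicalFunctor

/-! ### Completed Ext -/

variable [HasExt.{w} C]

/-- If every class of degree `> n` on `A` is a Yoneda product of `x : Ext A B n` with a class of
positive degree on `B`, and the image of `x` under `k` connecting homomorphisms to syzygies is zero,
then all classes of degree `> n + k` on `A` vanish: these are multiples of the iterated connecting
homomorphism of `x`, by dimension shifting in the first variable. -/
lemma ext_eq_zero_of_toStage_eq_zero {A : C} (k n : ℕ) {B : C} (x : Ext A B n)
    (hx : ∀ (j m : ℕ) (hm : n + (j + 1) = m) (Y : C) (y : Ext A Y m),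
      ∃ z : Ext B Y (j + 1), x.comp z hm = y)
    (h : (extCohomologicalFunctorOfHasExt A).toStage k (.ofNat n) B x = 0)
    (m : ℕ) (hm : n + k < m) (Y : C) (y : Ext A Y m) : y = 0 := by
  induction k generalizing n B with
  | zero =>
    obtain ⟨j, rfl⟩ := Nat.exists_eq_add_of_lt hm
    obtain ⟨z, rfl⟩ := hx j _ rfl Y y
    have h : x = 0 := h
    rw [h, Ext.zero_comp]
  | succ k ih =>
    have hS := syzygySeq_shortExact B
    refine ih (n + 1) (x.comp hS.extClass rfl) (fun j m hm Y y ↦ ?_) h (by lia)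
    obtain ⟨z, rfl⟩ := hx (j + 1) m (by lia) Y y
    obtain ⟨z, rfl⟩ := Ext.contravariant_sequence_exact₃ hS Y z
      (Ext.eq_zero_of_projective _) (add_comm 1 (j + 1))
    exact ⟨z, Ext.comp_assoc _ _ _ rfl (add_comm 1 (j + 1)) (by lia)⟩

/-- If the degree zero completed Ext group of `A` with itself is zero, then the identity of `A` dies
in the completion, and `A` has finite projective dimension. -/
lemma hasFiniteProjectiveDimension_of_isZero_complObj (A : C)
    (h : IsZero ((extCohomologicalFunctorOfHasExt A).complObj 0 A)) :
    HasFiniteProjectiveDimension A := by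
  let T := extCohomologicalFunctorOfHasExt A
  have hid : T.ι 0 0 A (Ext.mk₀ (𝟙 A)) = 0 := by
    rw [h.eq_of_tgt (T.ι 0 0 A) 0]
    rfl
  obtain ⟨k, hk⟩ := T.exists_toStage_eq_zero (n := 0) (Ext.mk₀ (𝟙 A)) hid
  have : HasProjectiveDimensionLT A (k + 1) := .mk fun m hm Y y ↦
    ext_eq_zero_of_toStage_eq_zero k 0 (Ext.mk₀ (𝟙 A))
      (fun j m hm Y y ↦ by
        obtain rfl : j + 1 = m := by lia
        exact ⟨y, by simp⟩) hk m (by lia) Y y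
  exact hasFiniteProjectiveDimension_of_hasProjectiveDimensionLT (k + 1) A

end ProjectiveDimension

section CompletedExt

variable {C : Type u} [Category.{v} C] [Abelian C] [EnoughProjectives C]

lemma nonempty_mislinCompletion_ext (X : C) :
    Nonempty (MislinCompletion (extCohomologicalFunctor X)) :=
  ⟨(extCohomologicalFunctor X).mislinCompletion⟩

lemma MislinCompletion.isZero_of_hasFiniteProjectiveDimension {A : C}
    (M : MislinCompletion (extCohomologicalFunctor A)) (hA : HasFiniteProjectiveDimension A)
    (n : ℤ) (B : C) : IsZero ((M.functor.T n).obj B) := by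
  let : HasExt.{v} C := hasExt_of_enoughProjectives.{v} C
  obtain ⟨N, _⟩ := hA.exists_hasProjectiveDimensionLT
  obtain ⟨e⟩ := M.nonempty_iso (extCohomologicalFunctor A).mislinCompletion n B
  exact (CohomologicalFunctor.isZero_complObj_of_isZero_above
    (T := extCohomologicalFunctorOfHasExt A) (isZero_extFunctorInt A N) n B).of_iso e

/-- The degree zero completed Ext group of `A` with itself detects finite projective dimension. -/
lemma MislinCompletion.isZero_iff_hasFiniteProjectiveDimension {A : C}
    (M : MislinCompletion (extCohomologicalFunctor A)) :
    IsZero ((M.functor.T 0).obj A) ↔ HasFiniteProjectiveDimension A := by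
  refine ⟨fun h ↦ ?_, fun h ↦ M.isZero_of_hasFiniteProjectiveDimension h 0 A⟩
  let : HasExt.{v} C := hasExt_of_enoughProjectives.{v} C
  obtain ⟨e⟩ := M.nonempty_iso (extCohomologicalFunctor A).mislinCompletion 0 A
  exact hasFiniteProjectiveDimension_of_isZero_complObj A (h.of_iso e.symm)

lemma MislinCompletion.tfae_hasFiniteProjectiveDimension
    (E : ∀ X : C, MislinCompletion (extCohomologicalFunctor X)) (A : C) :
    List.TFAE [HasFiniteProjectiveDimension A,
      ∀ n : ℤ, (∀ B : C, IsZero (((E A).functor.T n).obj B)) ∧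
        ∀ B : C, IsZero (((E B).functor.T n).obj A),
      IsZero (((E A).functor.T 0).obj A)] := by
  tfae_have 1 → 2 := fun h n ↦ by
    refine ⟨(E A).isZero_of_hasFiniteProjectiveDimension h n, fun B ↦ ?_⟩
    obtain ⟨N, _⟩ := h.exists_hasProjectiveDimensionLT
    exact (E B).vanishesOnProjectives.isZero_of_hasProjectiveDimensionLT N n A
  tfae_have 2 → 3 := fun h ↦ (h 0).1 A
  tfae_have 3 → 1 := (E A).isZero_iff_hasFiniteProjectiveDimension.1
  tfae_finish

end CompletedExt

section CondensedModules

/-! ### Condensed modules have enough projectives -/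

/-- The forgetful functor from sheaves of modules to sheaves of abelian groups preserves
epimorphisms: if `f` is an epimorphism with presheaf image factorization `f = e ≫ m`, then the
sheafification of `m` is both mono and epi, hence invertible, while sheafification preserves the
epimorphism of presheaves of abelian groups underlying `e`. -/
lemma epi_toSheaf_map {C : Type*} [Category* C] {J : GrothendieckTopology C}
    {R : Sheaf J RingCat.{u}} [HasSheafify J AddCommGrpCat.{v}]
    [J.WEqualsLocallyBijective AddCommGrpCat.{v}] {M N : SheafOfModules.{v} R} (f : M ⟶ N) [Epi f] :
    Epi ((SheafOfModules.toSheaf R).map f) := by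
  let adj := PresheafOfModules.sheafificationAdjunction.{v} (𝟙 R.obj)
  let a := PresheafOfModules.sheafification.{v} (𝟙 R.obj)
  let i := SheafOfModules.forget.{v} R ⋙ PresheafOfModules.restrictScalars (𝟙 R.obj)
  let e := Abelian.factorThruImage (i.map f)
  let m := Abelian.image.ι (i.map f)
  have hε : IsIso adj.counit := inferInstance
  have fac : a.map e ≫ a.map m ≫ adj.counit.app N = adj.counit.app M ≫ f := by
    rw [← a.map_comp_assoc, Abelian.image.fac]
    exact adj.counit.naturality f
  have : Epi (a.map m ≫ adj.counit.app N) := by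
    have : Epi (a.map e ≫ a.map m ≫ adj.counit.app N) := fac ▸ inferInstance
    exact epi_of_epi (a.map e) _
  have : IsIso (a.map m ≫ adj.counit.app N) := isIso_of_mono_of_epi _
  have : Epi ((SheafOfModules.toSheaf R).map (a.map e)) :=
    inferInstanceAs (Epi ((presheafToSheaf J AddCommGrpCat).map
      ((PresheafOfModules.toPresheaf R.obj).map (Abelian.factorThruImage (i.map f)))))
  rw [show f = inv (adj.counit.app M) ≫ a.map e ≫ a.map m ≫ adj.counit.app N by
    rw [fac, IsIso.inv_hom_id_assoc], Functor.map_comp, Functor.map_comp]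
  infer_instance

/-- A functor from a discrete category to types is projective, by choice. -/
lemma projective_discreteFunctor {α : Type v} (F : Discrete α ⥤ Type v) : Projective F where
  factors {E X} f e he := by
    rw [NatTrans.epi_iff_epi_app] at he
    refine ⟨Discrete.natTrans fun a ↦ Projective.factorThru (f.app a) (e.app a), ?_⟩
    ext1
    ext1 a
    simp

/-- A category with a faithful, epimorphism-preserving right adjoint functor to a category all of
whose objects are projective has enough projectives: the counit maps are epimorphisms from
projective objects. -/
lemma enoughProjectives_of_isRightAdjoint {C : Type*} [Category* C] {D : Type*} [Category* D]
    (F : C ⥤ D) [F.IsRightAdjoint] [F.Faithful] [F.PreservesEpimorphisms]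
    (hD : ∀ X : D, Projective X) : EnoughProjectives C where
  presentation X := by
    let adj := Adjunction.ofIsRightAdjoint F
    exact ⟨{
      p := F.leftAdjoint.obj (F.obj X)
      projective := adj.map_projective _ (hD _)
      f := adj.counit.app X }⟩

variable (R : Condensed.{u} RingCat.{u + 1})

/-- The functor sending a condensed module to the family of its sets of sections over extremally
disconnected compact Hausdorff spaces. -/
def stoneanSections : SheafOfModules.{u + 1} R ⥤ (Discrete Stonean.{u} ⥤ Type (u + 1)) :=
  (SheafOfModules.forget R ⋙ PresheafOfModules.restrictScalars (𝟙 R.obj)) ⋙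
    (PresheafOfModules.toPresheaf R.obj ⋙
      (Functor.whiskeringRight _ _ _).obj (forget AddCommGrpCat)) ⋙
    (Functor.whiskeringLeft _ _ _).obj
      (Discrete.functor fun S : Stonean.{u} ↦ Opposite.op S.compHaus)

/-- The left adjoint is a left Kan extension followed by the free presheaf of modules and
sheafification: it sends a family of sets to a sum of free condensed modules on extremally
disconnected spaces. -/
instance : (stoneanSections R).IsRightAdjoint := by
  have := (PresheafOfModules.sheafificationAdjunction.{u + 1} (𝟙 R.obj)).isRightAdjoint
  have := (PresheafOfModules.freeAdjunction.{u + 1} R.obj).isRightAdjoint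
  have : ((Functor.whiskeringLeft _ _ (Type (u + 1))).obj
      (Discrete.functor fun S : Stonean.{u} ↦ Opposite.op S.compHaus)).IsRightAdjoint :=
    (Functor.lanAdjunction _ _).isRightAdjoint
  unfold stoneanSections
  infer_instance

/-- Every compact Hausdorff space is covered by an extremally disconnected one, and the sections of
a sheaf are determined by their restrictions to a cover. -/
instance : (stoneanSections R).Faithful where
  map_injective {M N f g} h := by
    apply (SheafOfModules.toSheaf R).map_injective
    ext K x
    obtain ⟨K⟩ := K
    let F := (SheafOfModules.toSheaf R).obj N
    have hF : Presieve.IsSheaf (coherentTopology CompHaus) (F.obj ⋙ forget AddCommGrpCat) :=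
      (isSheaf_iff_isSheaf_of_type _ _).1
        ((Presheaf.isSheaf_iff_isSheaf_forget _ _ (forget AddCommGrpCat)).1 F.property)
    let π := CompHaus.presentation.π K
    have hπ : EffectiveEpi π := ((CompHaus.effectiveEpi_tfae π).out 0 1 :).2
      (CompHaus.presentation.epi_π K)
    have hcov : Sieve.generate (Presieve.singleton π) ∈ coherentTopology CompHaus K :=
      (coherentTopology.mem_sieves_iff_hasEffectiveEpiFamily _).2
        ⟨Unit, inferInstance, fun _ ↦ _, fun _ ↦ π, inferInstance,
          fun _ ↦ Sieve.le_generate _ _ _ ⟨⟩⟩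
    refine (hF.isSeparated _ hcov).ext ?_
    rintro Y _ ⟨Z, q, _, ⟨⟩, rfl⟩
    have key : F.obj.map π.op (((SheafOfModules.toSheaf R).map f).hom.app _ x) =
        F.obj.map π.op (((SheafOfModules.toSheaf R).map g).hom.app _ x) := by
      have h1 := NatTrans.naturality_apply ((SheafOfModules.toSheaf R).map f).hom π.op x
      have h2 := NatTrans.naturality_apply ((SheafOfModules.toSheaf R).map g).hom π.op x
      refine h1.symm.trans (Eq.trans ?_ h2)
      exact congr($(congr_app h ⟨K.presentation⟩)
        (((SheafOfModules.toSheaf R).obj M).obj.map π.op x))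
    have := congr(F.obj.map q.op $key)
    simpa using this

/-- An epimorphism of condensed modules is surjective on sections over extremally disconnected
spaces. -/
instance : (stoneanSections R).PreservesEpimorphisms where
  preserves {M N} f hf := by
    rw [NatTrans.epi_iff_epi_app]
    rintro ⟨S⟩
    rw [epi_iff_surjective]
    have : HasLimitsOfSize.{u, u + 1} AddCommGrpCat.{u + 1} :=
      hasLimitsOfSizeShrink.{u, u + 1, u + 1, u + 1} _
    exact (Condensed.epi_iff_surjective_on_stonean AddCommGrpCat.{u + 1}
      ((SheafOfModules.toSheaf R).map f)).1 (epi_toSheaf_map f) S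

/-- Condensed modules over a condensed ring have enough projectives. -/
instance enoughProjectives_condensedModule : EnoughProjectives (SheafOfModules.{u + 1} R) :=
  enoughProjectives_of_isRightAdjoint (stoneanSections R) projective_discreteFunctor

end CondensedModules

end

end CompleteCohomology

theorem theorem3p2 :
    -- abelian categories with enough projectives
    (∀ (C : Type u) [Category.{v} C] [Abelian C] [EnoughProjectives C],
      (∀ X : C, Nonempty (CompleteCohomology.MislinCompletion
        (CompleteCohomology.extCohomologicalFunctor X))) ∧
      ∀ (E : ∀ X : C, CompleteCohomology.MislinCompletion
          (CompleteCohomology.extCohomologicalFunctor X)) (A : C),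
        List.TFAE
          [CompleteCohomology.HasFiniteProjectiveDimension A,
            ∀ n : ℤ, (∀ B : C, IsZero (((E A).functor.T n).obj B)) ∧
              ∀ B : C, IsZero (((E B).functor.T n).obj A),
            IsZero (((E A).functor.T 0).obj A)]) ∧
    -- groups
    (∀ (R : Type u) [Ring R] (G : Type u) [Group G],
      Nonempty (CompleteCohomology.MislinCompletion
        (CompleteCohomology.groupCohomologyFunctor R G)) ∧
      ∀ H : CompleteCohomology.MislinCompletion (CompleteCohomology.groupCohomologyFunctor R G),
        IsZero ((H.functor.T 0).obj (CompleteCohomology.trivialModule R G)) ↔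
          CompleteCohomology.HasFiniteCohomologicalDimension R G) ∧
    -- condensed groups
    (∀ (R : Condensed.{u} RingCat.{u + 1}) (G : Condensed.{u} GrpCat.{u + 1}),
      ∃ _ : EnoughProjectives (CompleteCohomology.CondensedGroupModule R G),
        Nonempty (CompleteCohomology.MislinCompletion
          (CompleteCohomology.condensedGroupCohomologyFunctor R G)) ∧
        ∀ H : CompleteCohomology.MislinCompletion
            (CompleteCohomology.condensedGroupCohomologyFunctor R G),
          IsZero ((H.functor.T 0).obj (CompleteCohomology.condensedTrivialModule R G)) ↔
            CompleteCohomology.HasFiniteCondensedCohomologicalDimension R G) ∧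
    -- `T1` topological groups
    (∀ (R : Condensed.{u} RingCat.{u + 1}) (G : Type (u + 1)) [Group G] [TopologicalSpace G]
        [IsTopologicalGroup G] [T1Space G],
      ∃ _ : EnoughProjectives (CompleteCohomology.CondensedGroupModule R
          (CompleteCohomology.condensedGroupOfTopologicalGroup G)),
        Nonempty (CompleteCohomology.MislinCompletion
          (CompleteCohomology.condensedGroupCohomologyFunctor R
            (CompleteCohomology.condensedGroupOfTopologicalGroup G))) ∧
        ∀ H : CompleteCohomology.MislinCompletion
            (CompleteCohomology.condensedGroupCohomologyFunctor R
              (CompleteCohomology.condensedGroupOfTopologicalGroup G)),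
          IsZero ((H.functor.T 0).obj (CompleteCohomology.condensedTrivialModule R
              (CompleteCohomology.condensedGroupOfTopologicalGroup G))) ↔
            CompleteCohomology.HasFiniteCondensedCohomologicalDimension R
              (CompleteCohomology.condensedGroupOfTopologicalGroup G)) := by
  refine ⟨fun C _ _ _ ↦ ⟨fun X ↦ ?_, fun E A ↦ ?_⟩, fun R _ G _ ↦ ⟨?_, fun H ↦ ?_⟩,
    fun R G ↦ ⟨inferInstance, ?_, fun H ↦ ?_⟩,
    fun R G _ _ _ _ ↦ ⟨inferInstance, ?_, fun H ↦ ?_⟩⟩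
  · exact CompleteCohomology.nonempty_mislinCompletion_ext X
  · exact CompleteCohomology.MislinCompletion.tfae_hasFiniteProjectiveDimension E A
  · exact CompleteCohomology.nonempty_mislinCompletion_ext _
  · exact H.isZero_iff_hasFiniteProjectiveDimension
  · exact CompleteCohomology.nonempty_mislinCompletion_ext _
  · exact H.isZero_iff_hasFiniteProjectiveDimension
  · exact CompleteCohomology.nonempty_mislinCompletion_ext _
  · exact H.isZero_iff_hasFiniteProjectiveDimension
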